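/- Consider the Gaussian linear model $\mathbf Y=X\beta+\mathbf U$ with $n\ge 3$, a nonstochastic $n\times k$ matrix $X$ of rank $k$, $1\le k<n$, and $\mathbf U\sim N(0,\sigma^2\Sigma)$, where $0<\sigma^2<\infty$ and $\Sigma\in\mathfrak C$, a set of symmetric positive definite $n\times n$ matrices. Let $R$ be a $q\times k$ matrix of rank $q\ge 1$ and $r\in\mathbb R^q$; consider testing $R\beta=r$ against $R\beta\ne r$, and put $\mathfrak M_0=\{X\beta:R\beta=r\}$, $\mathfrak M_1=\{X\beta:R\beta\neq r\}$. Write $P_{\mu,\Phi}$ for the law $N(\mu,\Phi)$ on $\mathbb R^n$. Let $\hat\beta(y)=(X'X)^{-1}X'y$, $\hat u(y)=y-X\hat\beta(y)$, $\hat v_t(y)=\hat u_t(y)x_{t\cdot}'$ with $x_{t\cdot}$ the $t$-th row of $X$, $\hat\Gamma_j(y)=n^{-1}\sum_{t=j+1}^n\hat v_t(y)\hat v_{t-j}(y)'$ for $0\le j\le n-1$ and $\hat\Gamma_{j}=\hat\Gamma_{-j}'$ for $-(n-1)\le j<0$, $\hat\Psi_w(y)=\sum_{|j|\le n-1}w(j)\hat\Gamma_j(y)$,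 $\hat\Omega_w(y)=nR(X'X)^{-1}\hat\Psi_w(y)(X'X)^{-1}R'$, and $$T(y)=(R\hat\beta(y)-r)'\hat\Omega_w^{-1}(y)(R\hat\beta(y)-r)\ \text{ if }\det\hat\Omega_w(y)\ne0,\qquad T(y)=0\ \text{ otherwise.}$$ For $0<C<\infty$ let $W(C)=\{y\in\mathbb R^n:T(y)\ge C\}$ be the rejection region. Put $B(y)=R(X'X)^{-1}X'\,\mathrm{diag}(\hat u_1(y),\dots,\hat u_n(y))$. The size of the test is $\sup_{\mu_0\in\mathfrak M_0}\sup_{\sigma^2>0}\sup_{\Sigma\in\mathfrak C}P_{\mu_0,\sigma^2\Sigma}(W(C))$, its infimal power is $\inf_{\mu_1\in\mathfrak M_1}\inf_{\sigma^2>0}\inf_{\Sigma\in\mathfrak C}P_{\mu_1,\sigma^2\Sigma}(W(C))$, and it is biased if $P_{\mu_1,\sigma^2\Sigma}(W(C))$ is smaller than the size for some $\mu_1\in\mathfrak M_1$, $\sigma^2>0$, $\Sigma\in\mathfrak C$. Assume: * the weights satisfy $w(0)=1$, $w(-j)=w(j)$ for $|j|\le n-1$, and the Toeplitz matrix $(w(i-j))_{i,j=1}^n$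 is positive definite; * after deleting from $X'$ all columns whose index $i$ is such that the $i$-th standard basis vector of $\mathbb R^n$ lies in $\mathrm{span}(X)$, and calling the result $X'(\lnot)$, one has $\mathrm{rank}\,(R(X'X)^{-1}X'(\lnot))=q$; * $\mathfrak C\supseteq\mathfrak C_{AR(2)}$, the set of all $n\times n$ correlation matrices of $n$ consecutive elements of a stationary autoregressive process of order at most $2$ (driven by white noise with positive variance). For $\nu\in(0,\pi)$ let $E(\nu)$ be the $n\times2$ matrix with $t$-th row $(\cos(t\nu),\sin(t\nu))$; let $E(0)=(1,\dots,1)'$ and $E(\pi)=(-1,1,\dots,(-1)^n)'$. Let $\lambda_\nu$ be Lebesgue measure on $\mathrm{span}(E(\nu))$. Then: 1. Suppose that for some $\nu\in[0,\pi]$ and some $\mu_0^*\in\mathfrak M_0$ one has $\mathrm{rank}(B(z))=q$ and $T(z+\mu_0^*)>C$ for $\lambda_\nu$-almost all $z$. Then the same holds for this $\nu$ and all $\mu_0^*\in\mathfrak M_0$; moreover $\sup_{\Sigma\in\mathfrak C}P_{\mu_0,\sigma^2\Sigma}(W(C))=1$ for every $\mu_0\in\mathfrak M_0$ and every $0<\sigma^2<\infty$.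 In particular, the size of the test is $1$. 2. Suppose that for some $\nu\in[0,\pi]$ and some $\mu_0^*\in\mathfrak M_0$ one has $\mathrm{rank}(B(z))=q$ and $T(z+\mu_0^*)<C$ for $\lambda_\nu$-almost all $z$. Then the same holds for this $\nu$ and all $\mu_0^*\in\mathfrak M_0$; moreover $\inf_{\Sigma\in\mathfrak C}P_{\mu_0,\sigma^2\Sigma}(W(C))=0$ for every $\mu_0\in\mathfrak M_0$ and every $0<\sigma^2<\infty$, and $\inf_{\mu_1\in\mathfrak M_1}\inf_{\Sigma\in\mathfrak C}P_{\mu_1,\sigma^2\Sigma}(W(C))=0$ for every $0<\sigma^2<\infty$. The test is biased. Furthermore $\inf_{0<\sigma^2<\infty}\inf_{\Sigma\in\mathfrak C}P_{\mu_1,\sigma^2\Sigma}(W(C))=0$ for every $\mu_1\in\mathfrak M_1$. In particular, the infimal power of the test is $0$. 3. Suppose that for some $\nu\in[0,\pi]$ one has $B(z)=0$ and $R\hat\beta(z)\ne0$ for $\lambda_\nu$-almost all $z$. Then $\sup_{\Sigma\in\mathfrak C}P_{\mu_0,\sigma^2\Sigma}(W(C))=1$ for every $\mu_0\in\mathfrak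 M_0$ and every $0<\sigma^2<\infty$. In particular, the size of the test is $1$. For example, if $X=(E(\nu),X^{(2)})$ for some $\nu\in(0,\pi)$, $R=(I_2,0)$ and $r=0$ (testing for absence of seasonality at angular frequency $\nu$), then the size of the test is $1$. -/

import Mathlib

open MeasureTheory ProbabilityTheory Matrix
open scoped ENNReal

noncomputable section

namespace AutocorrRobust

/-! ### Covariance models of autoregressive processes -/

/-- White noise: square integrable, centered, uncorrelated over time, with a constant
positive variance. -/
structure IsWhiteNoise {Ω : Type} [MeasurableSpace Ω] (P : Measure Ω) (ε : ℤ → Ω → ℝ) :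
    Prop where
  memLp : ∀ t, MemLp (ε t) 2 P
  mean_zero : ∀ t, ∫ ω, ε t ω ∂P = 0
  uncorrelated : ∀ s t, s ≠ t → cov[ε s, ε t; P] = 0
  variance_const : ∀ t, Var[ε t; P] = Var[ε 0; P]
  variance_pos : 0 < Var[ε 0; P]

/-- Centered, weakly stationary process. -/
structure IsWeaklyStationary {Ω : Type} [MeasurableSpace Ω] (P : Measure Ω) (u : ℤ → Ω → ℝ) :
    Prop where
  memLp : ∀ t, MemLp (u t) 2 P
  mean_zero : ∀ t, ∫ ω, u t ω ∂P = 0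
  cov_shift : ∀ s t h, cov[u (s + h), u (t + h); P] = cov[u s, u t; P]

/-- A stationary autoregressive process of order not larger than `p` (some or all of the
coefficients `φ j` may be zero):
`u_t = φ_1 u_{t-1} + ... + φ_p u_{t-p} + ε_t` with white noise `ε`. -/
def IsStationaryAR (p : ℕ) {Ω : Type} [MeasurableSpace Ω] (P : Measure Ω)
    (u : ℤ → Ω → ℝ) : Prop :=
  IsWeaklyStationary P u ∧
    ∃ (φ : Fin p → ℝ) (ε : ℤ → Ω → ℝ), IsWhiteNoise P ε ∧
      ∀ t : ℤ, ∀ᵐ ω ∂P, u t ω = ∑ j : Fin p, φ j * u (t - ((j : ℤ) + 1)) ω + ε t ω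

/-- The correlation matrix of `(u_1, ..., u_n)`. -/
def correlationMatrix (n : ℕ) {Ω : Type} [MeasurableSpace Ω] (P : Measure Ω)
    (u : ℤ → Ω → ℝ) : Matrix (Fin n) (Fin n) ℝ :=
  Matrix.of fun i j =>
    cov[u ((i : ℤ) + 1), u ((j : ℤ) + 1); P] /
      (Real.sqrt Var[u ((i : ℤ) + 1); P] * Real.sqrt Var[u ((j : ℤ) + 1); P])

/-- The set of all `n × n` correlation matrices arising from stationary autoregressive
processes of order not larger than `p`. -/
def arCovarianceModel (n p : ℕ) : Set (Matrix (Fin n) (Fin n) ℝ) :=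
  {S | ∃ (Ω : Type) (_ : MeasurableSpace Ω) (P : Measure Ω) (u : ℤ → Ω → ℝ),
    IsProbabilityMeasure P ∧ IsStationaryAR p P u ∧ S = correlationMatrix n P u}

/-! ### Seasonal regressors and Lebesgue measure on subspaces -/

/-- The matrix `E(ν)` whose `t`-th row, `t = 1, ..., n`, is `(cos (t ν), sin (t ν))`.
For `ν = 0` and `ν = π` the sine column is zero, and the cosine column is
`e₊ = (1, ..., 1)'`, respectively `e₋ = (-1, 1, ..., (-1)^n)'`; so the column span is then
`span e₊`, respectively `span e₋`. -/
def seasonalMatrix (n : ℕ) (ν : ℝ) : Matrix (Fin n) (Fin 2) ℝ :=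
  Matrix.of fun t => ![Real.cos (((t : ℝ) + 1) * ν), Real.sin (((t : ℝ) + 1) * ν)]

/-- `span (E(ν))`, the column space of `E(ν)`. -/
def seasonalSpan (n : ℕ) (ν : ℝ) : Submodule ℝ (EuclideanSpace ℝ (Fin n)) :=
  Submodule.span ℝ (Set.range fun j : Fin 2 => WithLp.toLp 2 (fun t => seasonalMatrix n ν t j))

theorem seasonalSpan_zero (n : ℕ) :
    seasonalSpan n 0 = Submodule.span ℝ {WithLp.toLp 2 (fun _ : Fin n => (1 : ℝ))} := by
  have h0 : (WithLp.toLp 2 (fun _ : Fin n => (0 : ℝ)) : EuclideanSpace ℝ (Fin n)) = 0 := rfl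
  simp [seasonalSpan, seasonalMatrix, Set.range, Fin.exists_fin_two]
  rw [h0]
  refine le_antisymm (Submodule.span_le.2 ?_) (Submodule.span_mono ?_)
  · rintro x (hx | hx)
    · rw [← hx]; exact Submodule.mem_span_singleton_self _
    · rw [← hx]; exact Submodule.zero_mem _
  · rintro x hx
    exact Or.inl hx.symm

theorem seasonalSpan_pi (n : ℕ) :
    seasonalSpan n Real.pi =
      Submodule.span ℝ {WithLp.toLp 2 (fun t : Fin n => (-1 : ℝ) ^ ((t : ℕ) + 1))} := by
  have h0 : (WithLp.toLp 2 (fun _ : Fin n => (0 : ℝ)) : EuclideanSpace ℝ (Fin n)) = 0 := rfl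
  have hc : ∀ t : Fin n, Real.cos (((t : ℝ) + 1) * Real.pi) = (-1 : ℝ) ^ ((t : ℕ) + 1) := by
    intro t
    have := Real.cos_nat_mul_pi ((t : ℕ) + 1)
    push_cast at this
    exact this
  have hs : ∀ t : Fin n, Real.sin (((t : ℝ) + 1) * Real.pi) = 0 := by
    intro t
    have := Real.sin_nat_mul_pi ((t : ℕ) + 1)
    push_cast at this
    exact this
  simp only [seasonalSpan, seasonalMatrix, Set.range, Fin.exists_fin_two, Matrix.of_apply,
    Matrix.cons_val_zero, Matrix.cons_val_one, hc, hs]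
  rw [h0]
  refine le_antisymm (Submodule.span_le.2 ?_) (Submodule.span_mono ?_)
  · rintro x (hx | hx)
    · rw [← hx]; exact Submodule.mem_span_singleton_self _
    · rw [← hx]; exact Submodule.zero_mem _
  · rintro x hx
    exact Or.inl hx.symm

/-- Lebesgue measure on a linear subspace `S` of `ℝⁿ` (the Haar measure giving mass one to the
unit cube of an orthonormal basis of `S`), viewed as a Borel measure on `ℝⁿ`. -/
def lebesgueOn {n : ℕ} (S : Submodule ℝ (EuclideanSpace ℝ (Fin n))) :
    Measure (EuclideanSpace ℝ (Fin n)) :=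
  ((stdOrthonormalBasis ℝ S).toBasis.addHaar).map Subtype.val

/-! ### The linear regression model and the testing problem -/

section Model

variable {n k q : ℕ} (X : Matrix (Fin n) (Fin k) ℝ) (R : Matrix (Fin q) (Fin k) ℝ)
  (r : Fin q → ℝ) (w : ℤ → ℝ)

/-- The set `𝔐₀` of means `X β` with `R β = r`. -/
def nullMeans : Set (EuclideanSpace ℝ (Fin n)) :=
  {μ | ∃ β : Fin k → ℝ, μ = WithLp.toLp 2 (X *ᵥ β) ∧ R *ᵥ β = r}

/-- The set `𝔐₁` of means `X β` with `R β ≠ r`. -/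
def altMeans : Set (EuclideanSpace ℝ (Fin n)) :=
  {μ | ∃ β : Fin k → ℝ, μ = WithLp.toLp 2 (X *ᵥ β) ∧ R *ᵥ β ≠ r}

/-- The rejection probability `P_{μ, σ² S}(W)` of the test with rejection region `W`. -/
def rejProb (W : Set (EuclideanSpace ℝ (Fin n))) (μ : EuclideanSpace ℝ (Fin n)) (σ : ℝ)
    (S : Matrix (Fin n) (Fin n) ℝ) : ℝ≥0∞ :=
  multivariateGaussian μ (σ ^ 2 • S) W

/-- Size of the test with rejection region `W` for the covariance model `𝒞`. -/
def size (𝒞 : Set (Matrix (Fin n) (Fin n) ℝ)) (W : Set (EuclideanSpace ℝ (Fin n))) : ℝ≥0∞ :=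
  ⨆ μ ∈ nullMeans X R r, ⨆ σ ∈ Set.Ioi (0 : ℝ), ⨆ S ∈ 𝒞, rejProb W μ σ S

/-- Infimal power of the test with rejection region `W`. -/
def infimalPower (𝒞 : Set (Matrix (Fin n) (Fin n) ℝ))
    (W : Set (EuclideanSpace ℝ (Fin n))) : ℝ≥0∞ :=
  ⨅ μ ∈ altMeans X R r, ⨅ σ ∈ Set.Ioi (0 : ℝ), ⨅ S ∈ 𝒞, rejProb W μ σ S

/-- The test is biased: at some point of the alternative its power is less than its size. -/
def IsBiased (𝒞 : Set (Matrix (Fin n) (Fin n) ℝ)) (W : Set (EuclideanSpace ℝ (Fin n))) : Prop :=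
  ∃ μ ∈ altMeans X R r, ∃ σ ∈ Set.Ioi (0 : ℝ), ∃ S ∈ 𝒞, rejProb W μ σ S < size X R r 𝒞 W

/-! ### The test statistic -/

/-- Least squares estimator `(X'X)⁻¹ X' y`. -/
def betaHat (y : EuclideanSpace ℝ (Fin n)) : Fin k → ℝ :=
  ((Xᵀ * X)⁻¹ * Xᵀ) *ᵥ y.ofLp

/-- Least squares residuals `y - X β̂(y)`. -/
def resid (y : EuclideanSpace ℝ (Fin n)) : Fin n → ℝ :=
  y.ofLp - X *ᵥ betaHat X y

/-- `v̂_t(y) = û_t(y) x_t'`, where `x_t` is the `t`-th row of `X`. -/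
def scoreHat (y : EuclideanSpace ℝ (Fin n)) (t : Fin n) : Fin k → ℝ :=
  resid X y t • X t

/-- `Γ̂_j(y) = n⁻¹ ∑_{t=j+1}^n v̂_t(y) v̂_{t-j}(y)'` for a lag `j ≥ 0`: the sum runs over
all pairs `(t, s)` of time points with `t = s + j`. -/
def gammaHatNat (y : EuclideanSpace ℝ (Fin n)) (j : ℕ) : Matrix (Fin k) (Fin k) ℝ :=
  (n : ℝ)⁻¹ • ∑ t : Fin n, ∑ s : Fin n,
    if (t : ℕ) = (s : ℕ) + j then vecMulVec (scoreHat X y t) (scoreHat X y s) else 0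

/-- `Γ̂_j(y)` for an integer lag `j`, with `Γ̂_j(y) = Γ̂_{-j}(y)'` for `j < 0`. -/
def gammaHat (y : EuclideanSpace ℝ (Fin n)) (j : ℤ) : Matrix (Fin k) (Fin k) ℝ :=
  if 0 ≤ j then gammaHatNat X y j.toNat else (gammaHatNat X y (-j).toNat)ᵀ

/-- `Ψ̂_w(y) = ∑_{j=-(n-1)}^{n-1} w(j) Γ̂_j(y)`. -/
def psiHat (y : EuclideanSpace ℝ (Fin n)) : Matrix (Fin k) (Fin k) ℝ :=
  ∑ j ∈ Finset.Icc (-((n : ℤ) - 1)) ((n : ℤ) - 1), w j • gammaHat X y j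

/-- `Ω̂_w(y) = n R (X'X)⁻¹ Ψ̂_w(y) (X'X)⁻¹ R'`. -/
def omegaHat (y : EuclideanSpace ℝ (Fin n)) : Matrix (Fin q) (Fin q) ℝ :=
  (n : ℝ) • (R * (Xᵀ * X)⁻¹ * psiHat X w y * (Xᵀ * X)⁻¹ * Rᵀ)

open Classical in
/-- The test statistic `T`. -/
def testStat (y : EuclideanSpace ℝ (Fin n)) : ℝ :=
  if (omegaHat X R w y).det ≠ 0 then
    (R *ᵥ betaHat X y - r) ⬝ᵥ ((omegaHat X R w y)⁻¹ *ᵥ (R *ᵥ betaHat X y - r))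
  else 0

/-- The rejection region `W(C) = {y : T(y) ≥ C}`. -/
def rejRegion (C : ℝ) : Set (EuclideanSpace ℝ (Fin n)) :=
  {y | C ≤ testStat X R r w y}

/-- `B(y) = R (X'X)⁻¹ X' diag(û_1(y), ..., û_n(y))`. -/
def matB (y : EuclideanSpace ℝ (Fin n)) : Matrix (Fin q) (Fin n) ℝ :=
  R * (Xᵀ * X)⁻¹ * Xᵀ * Matrix.diagonal (resid X y)

/-- Assumption on the weights `w(j)`, `|j| ≤ n - 1` (values at other `j` play no role):
`w(0) = 1`, symmetry, and positive definiteness of the Toeplitz matrix `(w(i - j))`. -/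
structure WeightAssumption (n : ℕ) (w : ℤ → ℝ) : Prop where
  zero : w 0 = 1
  symm : ∀ j : ℤ, |j| ≤ (n : ℤ) - 1 → w (-j) = w j
  posDef : (Matrix.of fun i j : Fin n => w ((i : ℤ) - (j : ℤ))).PosDef

open Classical in
/-- Assumption on `X` and `R`: after deleting from `X'` all columns with an index `i` such that
the standard basis vector `e_i` lies in `span X`, the matrix `R (X'X)⁻¹ X'` still has
rank `q`. -/
def DesignAssumption : Prop :=
  (R * (Xᵀ * X)⁻¹ *
    Xᵀ.submatrix id
      (Subtype.val : {i : Fin n // ¬ ∃ β : Fin k → ℝ, X *ᵥ β = Pi.single i 1} → Fin n)).rank = q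

end Model

end AutocorrRobust

end

open AutocorrRobust

/-! ### Gaussian laws with converging, possibly singular covariance matrices. -/

section Gaussian

open Filter Topology
open scoped MatrixOrder

/-! The model contains correlation matrices that are nearly singular in a direction of choice. A
stationary AR(2) process with characteristic roots `ρ⁻¹ exp(± i ν)` has, as `ρ → 1`,
autocorrelations tending to `cos (h ν)`, so its correlation matrices tend to `E(ν) E(ν)'`
(`exists_tendsto_seasonal`). The limiting Gaussian law lives on `μ₀ + span E(ν)` and gives no mass
to translates of `λ_ν`-null sets. Hence any open set containing `μ₀ + z` for `λ_ν`-almost all `z`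
has probability tending to one (`exists_concentrating`).

In Parts 1 and 2 the open sets are `{det Ω̂ ≠ 0, T > C}` and `{det Ω̂ ≠ 0, T < C}`; they are open
because `T` is continuous where `Ω̂` is nonsingular, and `Ω̂ = B W B'` with `W` the positive
definite weight matrix, so rank `q` of `B` implies nonsingularity (`omegaHat_eq`). The choice of
`μ₀*` is immaterial because `T(μ₀ + z)` is the statistic for `r = 0` at `z`. For power, the means
may move within the alternative towards `μ₀`. A fixed alternative with growing `σ` reduces to this
case by invariance of `T` under rescaling about `μ₀` (`tendsto_rejProb_large_scale`). Bias follows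
since the size is positive (`size_pos`).

In Part 3 `Ω̂` vanishes on the limiting support, where `T` is `0` by convention, so continuity of
`T` is useless. With `v = R β̂ - r`, the open condition `C v'Ω̂v < (v'v)²` replaces `T > C`: it
holds on the support, and by Cauchy-Schwarz it implies `T > C` wherever `Ω̂` is nonsingular
(`lt_quadForm_inv`). The exceptional singular set is null under every law in the model
(`null_det_omegaHat`), by the design assumption. -/

open scoped Matrix.Norms.L2Operator in
theorem tendsto_matrix_sqrt {n : ℕ} {S : ℕ → Matrix (Fin n) (Fin n) ℝ}
    {T : Matrix (Fin n) (Fin n) ℝ} (hS : ∀ m, (S m).PosSemidef) (hT : T.PosSemidef)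
    (h : Tendsto S atTop (𝓝 T)) :
    Tendsto (fun m => CFC.sqrt (S m)) atTop (𝓝 (CFC.sqrt T)) := by
  have hc := CFC.continuousOn_sqrt (A := Matrix (Fin n) (Fin n) ℝ) T hT.nonneg
  exact hc.tendsto.comp (tendsto_nhdsWithin_iff.2 ⟨h, Eventually.of_forall fun m => (hS m).nonneg⟩)

theorem tendsto_toEuclideanCLM_apply {n : ℕ} {A : ℕ → Matrix (Fin n) (Fin n) ℝ}
    {B : Matrix (Fin n) (Fin n) ℝ} (h : Tendsto A atTop (𝓝 B)) (x : EuclideanSpace ℝ (Fin n)) :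
    Tendsto (fun m => toEuclideanCLM (𝕜 := ℝ) (A m) x) atTop
      (𝓝 (toEuclideanCLM (𝕜 := ℝ) B x)) := by
  have h1 : Continuous fun M : Matrix (Fin n) (Fin n) ℝ => WithLp.toLp 2 (M *ᵥ x.ofLp) := by
    fun_prop
  exact (h1.tendsto B).comp h

theorem multivariateGaussian_apply {n : ℕ} (μ : EuclideanSpace ℝ (Fin n))
    (S : Matrix (Fin n) (Fin n) ℝ) {G : Set (EuclideanSpace ℝ (Fin n))} (hG : MeasurableSet G) :
    multivariateGaussian μ S G = stdGaussian (EuclideanSpace ℝ (Fin n))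
      {x | μ + toEuclideanCLM (𝕜 := ℝ) (CFC.sqrt S) x ∈ G} := by
  rw [multivariateGaussian, Measure.map_apply (by fun_prop) hG]
  rfl

/-- The mass that Gaussian laws put on an open set converges to one if the limiting
(possibly singular) Gaussian law is concentrated on that open set. -/
theorem tendsto_multivariateGaussian_one {n : ℕ} {μ : ℕ → EuclideanSpace ℝ (Fin n)}
    {S : ℕ → Matrix (Fin n) (Fin n) ℝ} {μ₀ : EuclideanSpace ℝ (Fin n)}
    {T : Matrix (Fin n) (Fin n) ℝ} (hμ : Tendsto μ atTop (𝓝 μ₀)) (hS : ∀ m, (S m).PosSemidef)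
    (hT : T.PosSemidef) (h : Tendsto S atTop (𝓝 T)) {G : Set (EuclideanSpace ℝ (Fin n))}
    (hG : IsOpen G)
    (hmem : ∀ᵐ x ∂stdGaussian (EuclideanSpace ℝ (Fin n)),
      μ₀ + toEuclideanCLM (𝕜 := ℝ) (CFC.sqrt T) x ∈ G) :
    Tendsto (fun m => multivariateGaussian (μ m) (S m) G) atTop (𝓝 1) := by
  -- All the laws are images of one standard Gaussian vector, so it suffices that the indicators
  -- converge pointwise; openness of `G` provides this.
  simp_rw [multivariateGaussian_apply _ _ hG.measurableSet]
  rw [← measure_univ (μ := stdGaussian (EuclideanSpace ℝ (Fin n)))]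
  have hmeas : ∀ m, MeasurableSet
      {x | μ m + toEuclideanCLM (𝕜 := ℝ) (CFC.sqrt (S m)) x ∈ G} := fun m =>
    (by fun_prop : Measurable fun x =>
      μ m + toEuclideanCLM (𝕜 := ℝ) (CFC.sqrt (S m)) x) hG.measurableSet
  refine tendsto_measure_of_ae_tendsto_indicator_of_isFiniteMeasure atTop MeasurableSet.univ
    hmeas ?_
  filter_upwards [hmem] with x hx
  have hlim : Tendsto (fun m => μ m + toEuclideanCLM (𝕜 := ℝ) (CFC.sqrt (S m)) x) atTop
      (𝓝 (μ₀ + toEuclideanCLM (𝕜 := ℝ) (CFC.sqrt T) x)) :=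
    hμ.add (tendsto_toEuclideanCLM_apply (tendsto_matrix_sqrt hS hT h) x)
  filter_upwards [hlim (hG.mem_nhds hx)] with m hm
  exact iff_of_true hm trivial

theorem absolutelyContinuous_pi {α : Type*} [MeasurableSpace α] {μ ν : Measure α} [SigmaFinite μ]
    [SigmaFinite ν] (h : μ ≪ ν) (n : ℕ) :
    Measure.pi (fun _ : Fin n => μ) ≪ Measure.pi (fun _ : Fin n => ν) := by
  induction n with
  | zero => rw [Measure.pi_of_empty, Measure.pi_of_empty]
  | succ n ih =>
    have e1 := (measurePreserving_piFinSuccAbove (fun _ : Fin (n + 1) => μ) 0).symm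
    have e2 := (measurePreserving_piFinSuccAbove (fun _ : Fin (n + 1) => ν) 0).symm
    rw [← e1.map_eq, ← e2.map_eq]
    exact (h.prod ih).map e1.measurable

theorem stdGaussian_absolutelyContinuous (n : ℕ) :
    stdGaussian (EuclideanSpace ℝ (Fin n)) ≪ volume := by
  have h1 : Measure.pi (fun _ : Fin n => gaussianReal 0 1) ≪ volume :=
    absolutelyContinuous_pi (gaussianReal_absolutelyContinuous 0 one_ne_zero) n
  rw [← map_pi_eq_stdGaussian]
  have h2 := (PiLp.volume_preserving_toLp (Fin n))
  rw [← h2.map_eq]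
  exact h1.map h2.measurable

instance isOpenPosMeasure_gaussianReal : (gaussianReal 0 1).IsOpenPosMeasure :=
  (gaussianReal_absolutelyContinuous' 0 one_ne_zero).isOpenPosMeasure

instance isOpenPosMeasure_stdGaussian (n : ℕ) :
    (stdGaussian (EuclideanSpace ℝ (Fin n))).IsOpenPosMeasure := by
  rw [← map_pi_eq_stdGaussian]
  exact Continuous.isOpenPosMeasure_map (by fun_prop) (WithLp.toLp_surjective 2)

theorem range_mul_transpose_self {n m : ℕ} (A : Matrix (Fin n) (Fin m) ℝ) :
    LinearMap.range (A * Aᵀ).mulVecLin = LinearMap.range A.mulVecLin := by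
  refine Submodule.eq_of_le_of_finrank_eq ?_ (Matrix.rank_self_mul_transpose A)
  rw [Matrix.mulVecLin_mul]
  exact LinearMap.range_comp_le_range _ _

/-- A symmetric matrix has the same range as its square, and `A * Aᵀ` has the same range as `A`.
This identifies the support of the limiting singular law. -/
theorem range_sqrt {n m : ℕ} {S : Matrix (Fin n) (Fin n) ℝ} {E : Matrix (Fin n) (Fin m) ℝ}
    {σ : ℝ} (hσ : σ ≠ 0) (hS : S = σ ^ 2 • (E * Eᵀ)) :
    LinearMap.range (CFC.sqrt S).mulVecLin = LinearMap.range E.mulVecLin := by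
  have hpos : S.PosSemidef := by
    rw [hS]
    have := (Matrix.posSemidef_self_mul_conjTranspose E).smul (sq_nonneg σ)
    simpa using this
  have hsymm : (CFC.sqrt S)ᵀ = CFC.sqrt S := by
    have := (Matrix.nonneg_iff_posSemidef.1 (CFC.sqrt_nonneg S)).1.eq
    rwa [Matrix.conjTranspose_eq_transpose_of_trivial] at this
  have h1 := range_mul_transpose_self (CFC.sqrt S)
  rw [hsymm, CFC.sqrt_mul_sqrt_self S hpos.nonneg] at h1
  rw [← h1, hS, ← range_mul_transpose_self E]
  ext x
  simp only [LinearMap.mem_range, Matrix.mulVecLin_apply, Matrix.smul_mulVec]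
  constructor
  · rintro ⟨y, rfl⟩
    exact ⟨σ ^ 2 • y, by rw [Matrix.mulVec_smul]⟩
  · rintro ⟨y, rfl⟩
    exact ⟨(σ ^ 2)⁻¹ • y, by
      rw [Matrix.mulVec_smul, smul_inv_smul₀ (pow_ne_zero 2 hσ)]⟩

end Gaussian

namespace AutocorrRobust

/-! ### Null sets of `λ_ν` and the limiting singular Gaussian law. -/

section Limit

open scoped MatrixOrder

theorem mem_seasonalSpan {n : ℕ} {ν : ℝ} {z : EuclideanSpace ℝ (Fin n)} :
    z ∈ seasonalSpan n ν ↔ ∃ a : Fin 2 → ℝ, z.ofLp = seasonalMatrix n ν *ᵥ a := by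
  rw [seasonalSpan, Submodule.mem_span_range_iff_exists_fun]
  refine exists_congr fun a => ?_
  constructor
  · rintro rfl
    ext t
    simp [Matrix.mulVec, dotProduct, mul_comm]
  · intro h
    ext t
    simp [h, Matrix.mulVec, dotProduct, mul_comm]

/-- The covariance matrix `σ² E(ν) E(ν)'` of the limiting singular Gaussian law. -/
noncomputable def limitCov (n : ℕ) (ν σ : ℝ) : Matrix (Fin n) (Fin n) ℝ :=
  σ ^ 2 • (seasonalMatrix n ν * (seasonalMatrix n ν)ᵀ)

theorem posSemidef_limitCov (n : ℕ) (ν σ : ℝ) : (limitCov n ν σ).PosSemidef := by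
  have := (Matrix.posSemidef_self_mul_conjTranspose (seasonalMatrix n ν)).smul (sq_nonneg σ)
  simpa [limitCov] using this

theorem ae_lebesgueOn_iff {n : ℕ} {V : Submodule ℝ (EuclideanSpace ℝ (Fin n))}
    {p : EuclideanSpace ℝ (Fin n) → Prop} :
    (∀ᵐ z ∂lebesgueOn V, p z) ↔
      ∀ᵐ z : V ∂((stdOrthonormalBasis ℝ V).toBasis.addHaar), p (z : EuclideanSpace ℝ (Fin n)) := by
  rw [lebesgueOn]
  exact (MeasurableEmbedding.subtype_coe V.closed_of_finiteDimensional.measurableSet).ae_map_iff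

/-- The preimage of a Haar-null set under a linear surjection is Lebesgue-null, and the standard
Gaussian law is absolutely continuous. -/
theorem ae_comp_of_ae_lebesgueOn {n : ℕ} {V : Submodule ℝ (EuclideanSpace ℝ (Fin n))}
    {L : EuclideanSpace ℝ (Fin n) →ₗ[ℝ] EuclideanSpace ℝ (Fin n)} (hL : LinearMap.range L = V)
    {p : EuclideanSpace ℝ (Fin n) → Prop} (hp : ∀ᵐ z ∂lebesgueOn V, p z) :
    ∀ᵐ x ∂stdGaussian (EuclideanSpace ℝ (Fin n)), p (L x) := by
  subst hL
  rw [ae_lebesgueOn_iff] at hp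
  refine (stdGaussian_absolutelyContinuous n).ae_le ?_
  obtain ⟨t, ht, htm, ht0⟩ := exists_measurable_superset_of_null (ae_iff.1 hp)
  have h1 := (MeasureTheory.ae_comp_linearMap_mem_iff L.rangeRestrict volume
    ((stdOrthonormalBasis ℝ (LinearMap.range L)).toBasis.addHaar)
    L.surjective_rangeRestrict htm.compl).2 (by rw [ae_iff]; simpa using ht0)
  filter_upwards [h1] with x hx
  by_contra hc
  exact hx (ht hc)

theorem ae_sqrt_limitCov {n : ℕ} {ν σ : ℝ} (hσ : σ ≠ 0) {p : EuclideanSpace ℝ (Fin n) → Prop}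
    (hp : ∀ᵐ z ∂lebesgueOn (seasonalSpan n ν), p z) :
    ∀ᵐ x ∂stdGaussian (EuclideanSpace ℝ (Fin n)),
      p (toEuclideanCLM (𝕜 := ℝ) (CFC.sqrt (limitCov n ν σ)) x) := by
  refine ae_comp_of_ae_lebesgueOn
    (L := (toEuclideanCLM (𝕜 := ℝ) (CFC.sqrt (limitCov n ν σ))).toLinearMap) ?_ hp
  have h := range_sqrt (S := limitCov n ν σ) hσ rfl
  ext z
  rw [mem_seasonalSpan]
  have h' : z.ofLp ∈ LinearMap.range (CFC.sqrt (limitCov n ν σ)).mulVecLin ↔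
      z.ofLp ∈ LinearMap.range (seasonalMatrix n ν).mulVecLin := by rw [h]
  simp only [LinearMap.mem_range, Matrix.mulVecLin_apply] at h'
  constructor
  · rintro ⟨x, rfl⟩
    obtain ⟨a, ha⟩ := h'.1 ⟨x.ofLp, rfl⟩
    exact ⟨a, ha.symm⟩
  · rintro ⟨a, ha⟩
    obtain ⟨x, hx⟩ := h'.2 ⟨a, ha.symm⟩
    exact ⟨WithLp.toLp 2 x, by ext i; exact congrFun hx i⟩

end Limit

end AutocorrRobust

namespace AutocorrRobust

/-! ### One-sided moving averages of an orthonormal sequence. -/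

section MovingAverage

open scoped RealInnerProductSpace

variable {H : Type*} [NormedAddCommGroup H] [InnerProductSpace ℝ H]

/-- The one-sided moving average `∑ ψ_j e_{t-j}` in a Hilbert space. -/
noncomputable def movingAverage (ψ : ℕ → ℝ) (e : ℤ → H) (t : ℤ) : H :=
  ∑' j : ℕ, ψ j • e (t - j)

variable {ψ : ℕ → ℝ} {e : ℤ → H}

theorem summable_movingAverage [CompleteSpace H] (hψ : Summable ψ) (he : Orthonormal ℝ e) (t : ℤ) :
    Summable fun j : ℕ => ψ j • e (t - j) := by
  refine Summable.of_norm ?_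
  simpa [norm_smul, he.norm_eq_one] using hψ.abs

theorem inner_movingAverage [CompleteSpace H] (hψ : Summable ψ) (he : Orthonormal ℝ e)
    (x : H) (t : ℤ) :
    ⟪x, movingAverage ψ e t⟫ = ∑' j : ℕ, ψ j * ⟪x, e (t - j)⟫ := by
  have h := (innerSL ℝ x).map_tsum (summable_movingAverage hψ he t)
  simpa [movingAverage, inner_smul_right] using h

theorem inner_movingAverage_self [CompleteSpace H] (hψ : Summable ψ) (he : Orthonormal ℝ e)
    (s t : ℤ) :
    ⟪movingAverage ψ e s, movingAverage ψ e t⟫ =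
      ∑' j : ℕ, ψ j * ∑' i : ℕ, ψ i * if t - j = s - i then 1 else 0 := by
  rw [inner_movingAverage hψ he]
  congr 1
  ext j
  rw [real_inner_comm, inner_movingAverage hψ he]
  simp only [orthonormal_iff_ite.1 he]

theorem inner_movingAverage_shift [CompleteSpace H] (hψ : Summable ψ) (he : Orthonormal ℝ e)
    (s t h : ℤ) :
    ⟪movingAverage ψ e (s + h), movingAverage ψ e (t + h)⟫ =
      ⟪movingAverage ψ e s, movingAverage ψ e t⟫ := by
  rw [inner_movingAverage_self hψ he, inner_movingAverage_self hψ he]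
  have : ∀ i j : ℕ, (t + h - j = s + h - i) ↔ (t - j = s - i) := fun i j => by omega
  simp only [this]

/-- Only `e` at times up to `s` enters the average at `s`. This orthogonality of future innovations
yields the Yule-Walker equations. -/
theorem inner_movingAverage_future [CompleteSpace H] (hψ : Summable ψ) (he : Orthonormal ℝ e)
    {s t : ℤ} (hst : s < t) : ⟪e t, movingAverage ψ e s⟫ = 0 := by
  rw [inner_movingAverage hψ he]
  have : ∀ j : ℕ, ψ j * ⟪e t, e (s - j)⟫ = 0 := fun j => by
    rw [orthonormal_iff_ite.1 he, if_neg (by omega), mul_zero]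
  simp [this]

theorem movingAverage_recursion [CompleteSpace H] (hψ : Summable ψ) (he : Orthonormal ℝ e)
    {a b : ℝ} (h0 : ψ 0 = 1) (h1 : ψ 1 = a) (h2 : ∀ j, ψ (j + 2) = a * ψ (j + 1) + b * ψ j)
    (t : ℤ) :
    movingAverage ψ e t =
      a • movingAverage ψ e (t - 1) + b • movingAverage ψ e (t - 2) + e t := by
  have hs := summable_movingAverage hψ he
  have hs' : Summable fun j : ℕ => ψ (j + 1) • e (t - 1 - (j + 1 : ℕ)) :=
    (summable_nat_add_iff 1).2 (hs (t - 1))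
  unfold movingAverage
  rw [(hs t).tsum_eq_zero_add, ((summable_nat_add_iff 1).2 (hs t)).tsum_eq_zero_add,
    (hs (t - 1)).tsum_eq_zero_add]
  have hterm : ∀ j : ℕ, ψ (j + 1 + 1) • e (t - ((j + 1 + 1 : ℕ) : ℤ)) =
      a • (ψ (j + 1) • e (t - 1 - (j + 1 : ℕ))) + b • (ψ j • e (t - 2 - j)) := by
    intro j
    have e1 : t - 1 - ((j + 1 : ℕ) : ℤ) = t - ((j + 1 + 1 : ℕ) : ℤ) := by push_cast; ring
    have e2 : t - 2 - (j : ℤ) = t - ((j + 1 + 1 : ℕ) : ℤ) := by push_cast; ring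
    rw [e1, e2, h2, add_smul, mul_smul, mul_smul]
  simp only [hterm]
  rw [(hs'.const_smul a).tsum_add ((hs (t - 2)).const_smul b), hs'.tsum_const_smul,
    (hs (t - 2)).tsum_const_smul, h0, h1]
  simp only [zero_add, Nat.cast_zero, Nat.cast_one, sub_zero, one_smul, smul_add]
  abel

end MovingAverage

/-! ### The AR(2) filter through Chebyshev polynomials. -/

section AutoregressiveFilter

open Polynomial.Chebyshev

/-- The coefficients of the power series `1 / (1 - 2 ρ cos ν z + ρ² z²)`. -/
noncomputable def arFilter (ρ ν : ℝ) (j : ℕ) : ℝ :=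
  ρ ^ j * (U ℝ (j : ℤ)).eval (Real.cos ν)

theorem arFilter_zero (ρ ν : ℝ) : arFilter ρ ν 0 = 1 := by simp [arFilter]

theorem arFilter_one (ρ ν : ℝ) : arFilter ρ ν 1 = 2 * ρ * Real.cos ν := by
  simp [arFilter]; ring

theorem arFilter_add_two (ρ ν : ℝ) (j : ℕ) :
    arFilter ρ ν (j + 2) =
      2 * ρ * Real.cos ν * arFilter ρ ν (j + 1) + -ρ ^ 2 * arFilter ρ ν j := by
  simp only [arFilter]
  push_cast
  rw [U_add_two]
  simp
  ring

/-- Since `U_{j+1} = x U_j + T_{j+1}`, each step adds at most one in absolute value. Unlike the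
quotient `sin ((j+1) ν) / sin ν`, this also covers `ν = 0` and `ν = π`. -/
theorem abs_eval_U_cos_le (ν : ℝ) (j : ℕ) :
    |(U ℝ (j : ℤ)).eval (Real.cos ν)| ≤ j + 1 := by
  induction j with
  | zero => simp
  | succ j ih =>
    push_cast
    rw [U_eq_X_mul_U_add_T]
    have hT : (T ℝ ((j : ℤ) + 1)).eval (Real.cos ν) = Real.cos (((j : ℤ) + 1 : ℤ) * ν) :=
      T_real_cos ν _
    simp only [Polynomial.eval_add, Polynomial.eval_mul, Polynomial.eval_X, hT]
    refine (abs_add_le _ _).trans (add_le_add ?_ (Real.abs_cos_le_one _))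
    rw [abs_mul]
    exact (mul_le_of_le_one_left (abs_nonneg _) (Real.abs_cos_le_one _)).trans ih

theorem summable_arFilter {ρ : ℝ} (hρ : |ρ| < 1) (ν : ℝ) : Summable (arFilter ρ ν) := by
  have h1 : Summable fun j : ℕ => ((j : ℝ) ^ 1 * |ρ| ^ j + |ρ| ^ j) :=
    (summable_pow_mul_geometric_of_norm_lt_one 1 (by simpa using hρ)).add
      (summable_geometric_of_lt_one (abs_nonneg ρ) hρ)
  refine Summable.of_norm_bounded h1 fun j => ?_
  rw [Real.norm_eq_abs, arFilter, abs_mul, abs_pow]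
  have := mul_le_mul_of_nonneg_left (abs_eval_U_cos_le ν j) (pow_nonneg (abs_nonneg ρ) j)
  linarith

end AutoregressiveFilter

/-! ### Realising the moving averages as stationary AR processes in `L²`. -/

section Stationary

open scoped RealInnerProductSpace

variable {Ω : Type} [MeasurableSpace Ω] {P : Measure Ω}

theorem covariance_eq_inner {f g : Lp ℝ 2 P} (hf : ∫ ω, f ω ∂P = 0) (hg : ∫ ω, g ω ∂P = 0) :
    cov[f, g; P] = ⟪f, g⟫ := by
  rw [covariance, L2.inner_def, hf, hg]
  simp [mul_comm]

theorem variance_eq_inner {f : Lp ℝ 2 P} (hf : ∫ ω, f ω ∂P = 0) : Var[f; P] = ⟪f, f⟫ := by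
  rw [← covariance_eq_inner hf hf, covariance_self (Lp.memLp f).aemeasurable]

theorem isWhiteNoise_of_orthonormal {e : ℤ → Lp ℝ 2 P} (he : Orthonormal ℝ e)
    (h0 : ∀ t, ∫ ω, e t ω ∂P = 0) : IsWhiteNoise P fun t => (e t : Ω → ℝ) where
  memLp t := Lp.memLp (e t)
  mean_zero := h0
  uncorrelated s t hst := by rw [covariance_eq_inner (h0 s) (h0 t), he.2 hst]
  variance_const t := by
    rw [variance_eq_inner (h0 t), variance_eq_inner (h0 0)]
    simp [he.norm_eq_one]
  variance_pos := by
    rw [variance_eq_inner (h0 0)]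
    simp [he.norm_eq_one]

variable [IsProbabilityMeasure P]

/-- Writing the mean as an inner product lets it pass through the infinite sum. -/
theorem inner_one_eq_integral (f : Lp ℝ 2 P) :
    ⟪indicatorConstLp 2 MeasurableSet.univ (measure_ne_top P _) (1 : ℝ), f⟫ = ∫ ω, f ω ∂P := by
  rw [L2.inner_indicatorConstLp_one, setIntegral_univ]

theorem integral_movingAverage {e : ℤ → Lp ℝ 2 P} {ψ : ℕ → ℝ} (hψ : Summable ψ)
    (he : Orthonormal ℝ e) (h0 : ∀ t, ∫ ω, e t ω ∂P = 0) (t : ℤ) :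
    ∫ ω, movingAverage ψ e t ω ∂P = 0 := by
  rw [← inner_one_eq_integral, inner_movingAverage hψ he]
  simp_rw [inner_one_eq_integral, h0, mul_zero, tsum_zero]

theorem isStationaryAR_movingAverage {e : ℤ → Lp ℝ 2 P} {ψ : ℕ → ℝ} {a b : ℝ}
    (hψ : Summable ψ) (he : Orthonormal ℝ e) (h0 : ∀ t, ∫ ω, e t ω ∂P = 0)
    (hψ0 : ψ 0 = 1) (hψ1 : ψ 1 = a) (hψ2 : ∀ j, ψ (j + 2) = a * ψ (j + 1) + b * ψ j) :
    IsStationaryAR 2 P fun t => ⇑(movingAverage ψ e t) := by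
  have hm := integral_movingAverage hψ he h0
  refine ⟨⟨fun t => Lp.memLp _, hm, fun s t h => ?_⟩, ![a, b], fun t => (e t : Ω → ℝ),
    isWhiteNoise_of_orthonormal he h0, fun t => ?_⟩
  · rw [covariance_eq_inner (hm _) (hm _), covariance_eq_inner (hm _) (hm _),
      inner_movingAverage_shift hψ he]
  · have h := movingAverage_recursion hψ he hψ0 hψ1 hψ2 t
    have h1 := Lp.coeFn_add (a • movingAverage ψ e (t - 1) + b • movingAverage ψ e (t - 2)) (e t)
    have h2 := Lp.coeFn_add (a • movingAverage ψ e (t - 1)) (b • movingAverage ψ e (t - 2))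
    have h3 := Lp.coeFn_smul a (movingAverage ψ e (t - 1))
    have h4 := Lp.coeFn_smul b (movingAverage ψ e (t - 2))
    rw [← h] at h1
    filter_upwards [h1, h2, h3, h4] with ω w1 w2 w3 w4
    rw [w1, Pi.add_apply, w2, Pi.add_apply, w3, w4]
    simp

/-- Take the coordinates of a countable product of standard Gaussian laws; independence gives
orthogonality. -/
theorem exists_orthonormal_mean_zero :
    ∃ (Ω : Type) (_ : MeasurableSpace Ω) (P : Measure Ω) (_ : IsProbabilityMeasure P)
      (e : ℤ → Lp ℝ 2 P), Orthonormal ℝ e ∧ ∀ t, ∫ ω, e t ω ∂P = 0 := by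
  let P : Measure (ℤ → ℝ) := Measure.infinitePi fun _ => gaussianReal 0 1
  have hlaw : ∀ t : ℤ, HasLaw (fun ω : ℤ → ℝ => ω t) (gaussianReal 0 1) P := fun t =>
    ⟨(measurable_pi_apply t).aemeasurable, Measure.infinitePi_map_eval _ t⟩
  have hL : ∀ t : ℤ, MemLp (fun ω : ℤ → ℝ => ω t) 2 P := fun t =>
    (memLp_id_gaussianReal (μ := 0) (v := 1) 2).comp_measurePreserving
      ⟨measurable_pi_apply t, Measure.infinitePi_map_eval _ t⟩
  have hind : iIndepFun (fun (t : ℤ) (ω : ℤ → ℝ) => ω t) P :=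
    iIndepFun_infinitePi (P := fun _ : ℤ => gaussianReal 0 1) (X := fun _ x => x)
      (fun _ => measurable_id)
  have hmean' : ∀ t : ℤ, ∫ ω, ω t ∂P = 0 := fun t => by
    rw [(hlaw t).integral_eq, integral_id_gaussianReal]
  have hmean : ∀ t : ℤ, ∫ ω, (hL t).toLp _ ω ∂P = 0 := fun t => by
    rw [integral_congr_ae (hL t).coeFn_toLp, hmean']
  refine ⟨ℤ → ℝ, inferInstance, P, inferInstance, fun t => (hL t).toLp _, ?_, hmean⟩
  rw [orthonormal_iff_ite]
  intro s t
  have hcov : ⟪(hL s).toLp _, (hL t).toLp _⟫ = cov[fun ω => ω s, fun ω => ω t; P] := by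
    rw [covariance, L2.inner_def, hmean', hmean']
    refine integral_congr_ae ?_
    filter_upwards [(hL s).coeFn_toLp, (hL t).coeFn_toLp] with ω h1 h2
    rw [h1, h2]
    simp [mul_comm]
  rw [hcov]
  split_ifs with hst
  · subst hst
    rw [covariance_self (measurable_pi_apply s).aemeasurable, (hlaw s).variance_eq,
      variance_id_gaussianReal]
    simp
  · exact (hind.indepFun hst).covariance_eq_zero (hL s) (hL t)

end Stationary

/-! ### Degeneration of AR(2) correlation matrices as the roots approach the unit circle. -/

section Approximation

open Filter Topology
open scoped RealInnerProductSpace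

/-- For `0 < ρ < 1` there is a stationary AR(2) process with characteristic roots
`ρ⁻¹ exp (± i ν)`; its autocorrelation function is determined by the Yule-Walker equations. -/
theorem exists_autocorrelation {ρ : ℝ} (hρ : |ρ| < 1) (ν : ℝ) (n : ℕ) :
    ∃ S ∈ arCovarianceModel n 2, ∃ g : ℤ → ℝ, (∀ i j : Fin n, S i j = g ((i : ℤ) - j)) ∧
      g 0 = 1 ∧ (∀ h, g (-h) = g h) ∧
      ∀ h, -1 ≤ h → g (h + 2) = 2 * ρ * Real.cos ν * g (h + 1) - ρ ^ 2 * g h := by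
  obtain ⟨Ω, mΩ, P, hP, e, he, h0⟩ := exists_orthonormal_mean_zero
  have hψ := summable_arFilter hρ ν
  set U := movingAverage (arFilter ρ ν) e with hU
  have hrec := movingAverage_recursion hψ he (arFilter_zero ρ ν) (arFilter_one ρ ν)
    (arFilter_add_two ρ ν)
  have hAR := isStationaryAR_movingAverage hψ he h0 (arFilter_zero ρ ν) (arFilter_one ρ ν)
    (arFilter_add_two ρ ν)
  have hshift := inner_movingAverage_shift hψ he
  have hfut := @inner_movingAverage_future _ _ _ _ e _ hψ he
  have hmean := integral_movingAverage hψ he h0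
  rw [← hU] at hrec hAR hshift hfut hmean
  -- The recursion at time `0` gives `⟪e 0, U 0⟫ = 1`, because the two lagged terms precede `e 0`.
  have hpos : 0 < ⟪U 0, U 0⟫ := by
    rw [real_inner_self_eq_norm_sq]
    refine pow_pos (norm_pos_iff.2 fun hz => ?_) 2
    have h1 : ⟪e 0, U 0⟫ = 1 := by
      rw [hrec 0, inner_add_right, inner_add_right, inner_smul_right, inner_smul_right,
        hfut (by norm_num), hfut (by norm_num), real_inner_self_eq_norm_sq, he.norm_eq_one]
      norm_num
    rw [hz, inner_zero_right] at h1
    exact zero_ne_one h1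
  have hlag : ∀ s t : ℤ, ⟪U s, U t⟫ = ⟪U (s - t), U 0⟫ := fun s t => by
    have := hshift (s - t) 0 t
    rwa [sub_add_cancel, zero_add] at this
  have hvar : ∀ t, Var[U t; P] = ⟪U 0, U 0⟫ := fun t => by
    rw [variance_eq_inner (hmean t), hlag, sub_self]
  refine ⟨_, ⟨Ω, mΩ, P, fun t => U t, hP, hAR, rfl⟩, fun h => ⟪U h, U 0⟫ / ⟪U 0, U 0⟫,
    fun i j => ?_, div_self hpos.ne', fun h => ?_, fun h hh => ?_⟩
  · rw [correlationMatrix, Matrix.of_apply, hvar, hvar, Real.mul_self_sqrt hpos.le,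
      covariance_eq_inner (hmean _) (hmean _), hlag, add_sub_add_right_eq_sub]
  · have := hlag 0 h
    rw [zero_sub] at this
    simp only
    rw [← this, real_inner_comm]
  · simp only
    -- The bound `-1 ≤ h` places the innovation at time `h + 2` strictly after time `0`, so it is
    -- orthogonal to `U 0`.
    rw [hrec (h + 2), inner_add_left, inner_add_left, inner_smul_left, inner_smul_left,
      hfut (by omega)]
    have e1 : h + 2 - 1 = h + 1 := by ring
    have e2 : h + 2 - 2 = h := by ring
    rw [e1, e2]
    simp only [conj_trivial]
    ring

theorem tendsto_autocorrelation {ν : ℝ} {ρ : ℕ → ℝ} (hρ : Tendsto ρ atTop (𝓝 1))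
    {g : ℕ → ℤ → ℝ} (h0 : ∀ m, g m 0 = 1) (hneg : ∀ m h, g m (-h) = g m h)
    (hrec : ∀ m h, -1 ≤ h →
      g m (h + 2) = 2 * ρ m * Real.cos ν * g m (h + 1) - ρ m ^ 2 * g m h) (h : ℤ) :
    Tendsto (fun m => g m h) atTop (𝓝 (Real.cos (h * ν))) := by
  -- At lag `-1`, symmetry closes the recursion: `(1 + ρ²) g(1) = 2 ρ cos ν`.
  have h1 : Tendsto (fun m => g m 1) atTop (𝓝 (Real.cos ν)) := by
    have : ∀ m, g m 1 = 2 * ρ m * Real.cos ν / (1 + ρ m ^ 2) := fun m => by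
      have := hrec m (-1) le_rfl
      norm_num [h0, hneg] at this
      rw [eq_div_iff (by positivity)]
      linarith
    simp_rw [this]
    have hl : Tendsto (fun m => 2 * ρ m * Real.cos ν / (1 + ρ m ^ 2)) atTop
        (𝓝 (2 * 1 * Real.cos ν / (1 + 1 ^ 2))) :=
      ((hρ.const_mul 2).mul_const _).div ((hρ.pow 2).const_add 1) (by norm_num)
    convert hl using 2
    ring
  -- The recursion has order two, so two consecutive lags are carried; its limit is the recursion
  -- satisfied by `cos (k ν)`.
  have hnat : ∀ k : ℕ, Tendsto (fun m => g m k) atTop (𝓝 (Real.cos (k * ν))) ∧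
      Tendsto (fun m => g m (k + 1)) atTop (𝓝 (Real.cos ((k + 1) * ν))) := by
    intro k
    induction k with
    | zero => simpa [h0] using h1
    | succ k ih =>
      refine ⟨by simpa using ih.2, ?_⟩
      have hl := (((hρ.const_mul 2).mul_const (Real.cos ν)).mul ih.2).sub ((hρ.pow 2).mul ih.1)
      have hc : Real.cos (((k + 1 : ℕ) + 1) * ν) =
          2 * 1 * Real.cos ν * Real.cos ((k + 1) * ν) - 1 ^ 2 * Real.cos (k * ν) := by
        have e1 : (((k + 1 : ℕ) : ℝ) + 1) * ν = (k + 1) * ν + ν := by push_cast; ring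
        have e2 : (k : ℝ) * ν = (k + 1) * ν - ν := by ring
        rw [e1, e2, Real.cos_add, Real.cos_sub]
        ring
      rw [hc]
      refine hl.congr fun m => ?_
      rw [← hrec m k (by omega)]
      congr 1
  obtain ⟨k, rfl | rfl⟩ := h.eq_nat_or_neg
  · simpa using (hnat k).1
  · simpa [hneg] using (hnat k).1

/-- The singular matrix `E(ν) E(ν)'` is a limit of AR(2) correlation matrices. -/
theorem exists_tendsto_seasonal (n : ℕ) (ν : ℝ) :
    ∃ S : ℕ → Matrix (Fin n) (Fin n) ℝ, (∀ m, S m ∈ arCovarianceModel n 2) ∧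
      Tendsto S atTop (𝓝 (seasonalMatrix n ν * (seasonalMatrix n ν)ᵀ)) := by
  have hρ : ∀ m : ℕ, |1 - 1 / ((m : ℝ) + 1)| < 1 := fun m => by
    have hm : 0 < 1 / ((m : ℝ) + 1) := by positivity
    have hm1 : 1 / ((m : ℝ) + 1) ≤ 1 := by
      rw [div_le_one (by positivity)]
      simp
    rw [abs_lt]
    constructor <;> linarith
  choose S hS g hSg h0 hneg hrec using fun m => exists_autocorrelation (hρ m) ν n
  have hlim : Tendsto (fun m : ℕ => 1 - 1 / ((m : ℝ) + 1)) atTop (𝓝 1) := by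
    simpa using (tendsto_one_div_add_atTop_nhds_zero_nat (𝕜 := ℝ)).const_sub 1
  refine ⟨S, hS, tendsto_pi_nhds.2 fun i => tendsto_pi_nhds.2 fun j => ?_⟩
  simp_rw [hSg]
  convert tendsto_autocorrelation hlim h0 hneg hrec ((i : ℤ) - j) using 2
  -- The cosine subtraction formula exhibits the entry as the inner product of rows `i` and `j` of
  -- `E(ν)`; the shift of the time index by one cancels.
  have : (((i : ℤ) - j : ℤ) : ℝ) * ν = ((i : ℝ) + 1) * ν - ((j : ℝ) + 1) * ν := by
    push_cast; ring
  rw [this, Real.cos_sub]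
  simp [Matrix.mul_apply, seasonalMatrix]

end Approximation

end AutocorrRobust

/-! ### Full-rank matrices and a quadratic form inequality. -/

section RankLemmas

theorem linearIndependent_row_of_rank_eq {q : ℕ} {ι : Type*} [Fintype ι] {M : Matrix (Fin q) ι ℝ}
    (h : M.rank = q) : LinearIndependent ℝ M.row := by
  rw [linearIndependent_iff_card_eq_finrank_span, Fintype.card_fin, Set.finrank,
    ← Matrix.rank_eq_finrank_span_row, h]

theorem mulVec_injective_of_rank_eq {n k : ℕ} {X : Matrix (Fin n) (Fin k) ℝ} (h : X.rank = k) :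
    Function.Injective X.mulVec := by
  rw [Matrix.mulVec_injective_iff, ← Matrix.row_transpose]
  exact linearIndependent_row_of_rank_eq (by rw [Matrix.rank_transpose, h])

theorem mulVec_surjective_of_rank_eq {q k : ℕ} {R : Matrix (Fin q) (Fin k) ℝ} (h : R.rank = q) :
    Function.Surjective R.mulVec := by
  have : LinearMap.range R.mulVecLin = ⊤ :=
    Submodule.eq_top_of_finrank_eq (by rw [Module.finrank_fin_fun]; exact h)
  intro v
  obtain ⟨x, hx⟩ := LinearMap.range_eq_top.1 this v
  exact ⟨x, hx⟩

theorem isUnit_det_gram {n k : ℕ} {X : Matrix (Fin n) (Fin k) ℝ} (h : X.rank = k) :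
    IsUnit (Xᵀ * X).det := by
  have := (Matrix.PosDef.conjTranspose_mul_self X (mulVec_injective_of_rank_eq h)).isUnit
  rw [Matrix.conjTranspose_eq_transpose_of_trivial] at this
  exact (Matrix.isUnit_iff_isUnit_det _).1 this

/-- A Cauchy-Schwarz bound for the quadratic form of the inverse of a positive definite matrix. -/
theorem lt_quadForm_inv {q : ℕ} {A : Matrix (Fin q) (Fin q) ℝ} (hA : A.PosDef) {v : Fin q → ℝ}
    {C : ℝ} (h : C * (v ⬝ᵥ A *ᵥ v) < (v ⬝ᵥ v) ^ 2) : C < v ⬝ᵥ A⁻¹ *ᵥ v := by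
  have hv : v ≠ 0 := by
    rintro rfl
    simp at h
  have ha : 0 < v ⬝ᵥ A *ᵥ v := by simpa using hA.dotProduct_mulVec_pos hv
  have hdet : IsUnit A.det := (Matrix.isUnit_iff_isUnit_det _).1 hA.isUnit
  have hx : A *ᵥ (A⁻¹ *ᵥ v) = v := by
    rw [Matrix.mulVec_mulVec, Matrix.mul_nonsing_inv _ hdet, Matrix.one_mulVec]
  set x := A⁻¹ *ᵥ v with hxdef
  have hsymm : x ⬝ᵥ A *ᵥ v = v ⬝ᵥ v := by
    have hAt : Aᵀ = A := by simpa [Matrix.conjTranspose_eq_transpose_of_trivial] using hA.1.eq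
    rw [Matrix.dotProduct_mulVec, ← Matrix.mulVec_transpose, hAt, hx]
  set a := v ⬝ᵥ A *ᵥ v
  set p := v ⬝ᵥ v
  -- Nonnegativity of the form at `a x - p v` is the Cauchy-Schwarz inequality `p² ≤ a (v ⬝ᵥ x)`
  -- after division by `a > 0`.
  have hq : 0 ≤ (a • x - p • v) ⬝ᵥ A *ᵥ (a • x - p • v) := by
    simpa using hA.posSemidef.dotProduct_mulVec_nonneg (a • x - p • v)
  have hexp : (a • x - p • v) ⬝ᵥ A *ᵥ (a • x - p • v) = a * (a * (v ⬝ᵥ x) - p ^ 2) := by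
    rw [Matrix.mulVec_sub, Matrix.mulVec_smul, Matrix.mulVec_smul, hx]
    simp only [sub_dotProduct, dotProduct_sub, smul_dotProduct, dotProduct_smul, smul_eq_mul,
      hsymm]
    rw [dotProduct_comm x v]
    change a * (a * (v ⬝ᵥ x) - p * p) - p * (a * p - p * a) = _
    ring
  rw [hexp] at hq
  have h1 := nonneg_of_mul_nonneg_right hq ha
  have h2 : a * C < a * (v ⬝ᵥ x) := by linarith
  exact lt_of_mul_lt_mul_left h2 ha.le

end RankLemmas

namespace AutocorrRobust

/-! ### Algebra, continuity and invariance of the test statistic. -/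

section Statistic

variable {n k q : ℕ} {X : Matrix (Fin n) (Fin k) ℝ} {R : Matrix (Fin q) (Fin k) ℝ}
  {r : Fin q → ℝ} {w : ℤ → ℝ}

/-- The Toeplitz matrix of the weights. -/
def weightMatrix (n : ℕ) (w : ℤ → ℝ) : Matrix (Fin n) (Fin n) ℝ :=
  Matrix.of fun i j : Fin n => w ((i : ℤ) - (j : ℤ))

theorem betaHat_add (y z : EuclideanSpace ℝ (Fin n)) :
    betaHat X (y + z) = betaHat X y + betaHat X z := by
  simp [betaHat, Matrix.mulVec_add]

theorem betaHat_smul (a : ℝ) (z : EuclideanSpace ℝ (Fin n)) :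
    betaHat X (a • z) = a • betaHat X z := by
  simp [betaHat, Matrix.mulVec_smul]

theorem betaHat_mulVec (hX : X.rank = k) (β : Fin k → ℝ) :
    betaHat X (WithLp.toLp 2 (X *ᵥ β)) = β := by
  rw [betaHat, Matrix.mulVec_mulVec, Matrix.mul_assoc,
    Matrix.nonsing_inv_mul _ (isUnit_det_gram hX), Matrix.one_mulVec]

theorem resid_add (y z : EuclideanSpace ℝ (Fin n)) :
    resid X (y + z) = resid X y + resid X z := by
  simp only [resid, betaHat_add, Matrix.mulVec_add, WithLp.ofLp_add]
  abel

theorem resid_smul (a : ℝ) (z : EuclideanSpace ℝ (Fin n)) :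
    resid X (a • z) = a • resid X z := by
  simp [resid, betaHat_smul, Matrix.mulVec_smul, smul_sub]

theorem resid_mulVec (hX : X.rank = k) (β : Fin k → ℝ) :
    resid X (WithLp.toLp 2 (X *ᵥ β)) = 0 := by
  simp [resid, betaHat_mulVec hX]

/-- Transposing at a negative lag amounts to swapping `t` and `s`, so one formula serves both signs.
-/
theorem gammaHat_apply (hn : n ≠ 0) (y : EuclideanSpace ℝ (Fin n)) (j : ℤ) (a b : Fin k) :
    (n : ℝ) * gammaHat X y j a b = ∑ t : Fin n, ∑ s : Fin n,
      if (t : ℤ) - s = j then scoreHat X y t a * scoreHat X y s b else 0 := by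
  have hn' : (n : ℝ) ≠ 0 := Nat.cast_ne_zero.2 hn
  have key : ∀ (i : ℕ) (a b : Fin k), (n : ℝ) * gammaHatNat X y i a b =
      ∑ t : Fin n, ∑ s : Fin n,
        if (t : ℕ) = s + i then scoreHat X y t a * scoreHat X y s b else 0 := by
    intro i a b
    rw [gammaHatNat, Matrix.smul_apply, smul_eq_mul, mul_inv_cancel_left₀ hn', Matrix.sum_apply]
    refine Finset.sum_congr rfl fun t _ => ?_
    rw [Matrix.sum_apply]
    refine Finset.sum_congr rfl fun s _ => ?_
    split_ifs <;> simp [Matrix.vecMulVec_apply]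
  rw [gammaHat]
  split_ifs with hj
  · rw [key]
    refine Finset.sum_congr rfl fun t _ => Finset.sum_congr rfl fun s _ => ?_
    exact if_congr (by omega) rfl rfl
  · rw [Matrix.transpose_apply, key, Finset.sum_comm]
    refine Finset.sum_congr rfl fun t _ => Finset.sum_congr rfl fun s _ => ?_
    exact if_congr (by omega) (mul_comm _ _) rfl

/-- Every pair `(t, s)` has exactly one lag `t - s`, and it lies in the summation range, so the sum
over lags collapses to Toeplitz weights. -/
theorem smul_psiHat (hn : n ≠ 0) (y : EuclideanSpace ℝ (Fin n)) :
    (n : ℝ) • psiHat X w y = Xᵀ * Matrix.diagonal (resid X y) * weightMatrix n w *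
      (Matrix.diagonal (resid X y) * X) := by
  ext a b
  have hl : ((n : ℝ) • psiHat X w y) a b = ∑ t : Fin n, ∑ s : Fin n,
      w ((t : ℤ) - s) * (scoreHat X y t a * scoreHat X y s b) := by
    rw [Matrix.smul_apply, psiHat, Matrix.sum_apply, smul_eq_mul, Finset.mul_sum]
    simp_rw [Matrix.smul_apply, smul_eq_mul, mul_left_comm (n : ℝ), gammaHat_apply hn,
      Finset.mul_sum]
    rw [Finset.sum_comm]
    refine Finset.sum_congr rfl fun t _ => ?_
    rw [Finset.sum_comm]
    refine Finset.sum_congr rfl fun s _ => ?_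
    simp_rw [mul_ite, mul_zero]
    rw [Finset.sum_ite_eq, if_pos (Finset.mem_Icc.2 (by omega))]
  rw [hl, Matrix.mul_apply]
  simp_rw [Matrix.mul_apply (M := Xᵀ * Matrix.diagonal (resid X y)), Matrix.mul_diagonal,
    Matrix.diagonal_mul, Finset.sum_mul]
  rw [Finset.sum_comm]
  refine Finset.sum_congr rfl fun s _ => Finset.sum_congr rfl fun t _ => ?_
  simp only [weightMatrix, scoreHat, Matrix.of_apply, Matrix.transpose_apply, Pi.smul_apply,
    smul_eq_mul]
  ring

/-- This sandwich form is the source of semidefiniteness, continuity, translation invariance along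
`X β` and quadratic homogeneity. -/
theorem omegaHat_eq (hn : n ≠ 0) (y : EuclideanSpace ℝ (Fin n)) :
    omegaHat X R w y = matB X R y * weightMatrix n w * (matB X R y)ᵀ := by
  have h : omegaHat X R w y =
      R * (Xᵀ * X)⁻¹ * ((n : ℝ) • psiHat X w y) * (Xᵀ * X)⁻¹ * Rᵀ := by
    rw [omegaHat, Matrix.mul_smul, Matrix.smul_mul, Matrix.smul_mul]
  rw [h, smul_psiHat hn, matB]
  simp only [Matrix.transpose_mul, Matrix.diagonal_transpose, Matrix.transpose_transpose,
    Matrix.transpose_nonsing_inv, Matrix.mul_assoc]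

theorem posDef_omegaHat (hn : n ≠ 0) (hw : WeightAssumption n w)
    {y : EuclideanSpace ℝ (Fin n)} (h : (matB X R y).rank = q) : (omegaHat X R w y).PosDef := by
  rw [omegaHat_eq hn, ← Matrix.conjTranspose_eq_transpose_of_trivial]
  exact hw.posDef.mul_mul_conjTranspose_same
    (Matrix.vecMul_injective_iff.2 (linearIndependent_row_of_rank_eq h))

theorem posSemidef_omegaHat (hn : n ≠ 0) (hw : WeightAssumption n w)
    (y : EuclideanSpace ℝ (Fin n)) : (omegaHat X R w y).PosSemidef := by
  rw [omegaHat_eq hn, ← Matrix.conjTranspose_eq_transpose_of_trivial]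
  exact hw.posDef.posSemidef.mul_mul_conjTranspose_same _

theorem posDef_omegaHat_of_det_ne_zero (hn : n ≠ 0) (hw : WeightAssumption n w)
    {y : EuclideanSpace ℝ (Fin n)} (h : (omegaHat X R w y).det ≠ 0) :
    (omegaHat X R w y).PosDef :=
  (posSemidef_omegaHat hn hw y).posDef_iff_det_ne_zero.2 h

theorem det_omegaHat_ne_zero (hn : n ≠ 0) (hw : WeightAssumption n w)
    {y : EuclideanSpace ℝ (Fin n)} (h : (matB X R y).rank = q) : (omegaHat X R w y).det ≠ 0 :=
  ((Matrix.isUnit_iff_isUnit_det _).1 (posDef_omegaHat hn hw h).isUnit).ne_zero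

@[fun_prop]
theorem continuous_betaHat : Continuous (betaHat X) := by
  unfold betaHat
  fun_prop

@[fun_prop]
theorem continuous_resid : Continuous (resid X) := by
  unfold resid
  fun_prop

@[fun_prop]
theorem continuous_matB : Continuous (matB X R) := by
  unfold matB
  fun_prop

theorem continuous_omegaHat (hn : n ≠ 0) : Continuous (omegaHat X R w) := by
  have : omegaHat X R w = fun y => matB X R y * weightMatrix n w * (matB X R y)ᵀ :=
    funext fun y => omegaHat_eq hn y
  rw [this]
  fun_prop

theorem isOpen_det_omegaHat_ne_zero (hn : n ≠ 0) :
    IsOpen {y : EuclideanSpace ℝ (Fin n) | (omegaHat X R w y).det ≠ 0} :=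
  isOpen_ne_fun (continuous_omegaHat hn).matrix_det continuous_const

theorem continuousOn_testStat (hn : n ≠ 0) :
    ContinuousOn (testStat X R r w)
      {y : EuclideanSpace ℝ (Fin n) | (omegaHat X R w y).det ≠ 0} := by
  have hΩ : Continuous (omegaHat X R w) := continuous_omegaHat hn
  have hv : Continuous fun y => R *ᵥ betaHat X y - r := by fun_prop
  -- Writing the inverse as adjugate over determinant leaves only a division to control.
  have h : ContinuousOn (fun y => (R *ᵥ betaHat X y - r) ⬝ᵥ
      (((omegaHat X R w y).det)⁻¹ • ((omegaHat X R w y).adjugate *ᵥ (R *ᵥ betaHat X y - r))))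
      {y : EuclideanSpace ℝ (Fin n) | (omegaHat X R w y).det ≠ 0} := by
    have h1 : ContinuousOn (fun y => ((omegaHat X R w y).det)⁻¹)
        {y : EuclideanSpace ℝ (Fin n) | (omegaHat X R w y).det ≠ 0} :=
      hΩ.matrix_det.continuousOn.inv₀ fun y hy => hy
    have h2 : Continuous fun y =>
        (R *ᵥ betaHat X y - r) ⬝ᵥ ((omegaHat X R w y).adjugate *ᵥ (R *ᵥ betaHat X y - r)) :=
      hv.dotProduct (hΩ.matrix_adjugate.matrix_mulVec hv)
    simp_rw [dotProduct_smul, smul_eq_mul]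
    exact h1.mul h2.continuousOn
  refine h.congr fun y hy => ?_
  rw [testStat, if_pos (Set.mem_ofPred.1 hy), Matrix.inv_def, Ring.inverse_eq_inv', Matrix.smul_mulVec]

theorem isOpen_lt_testStat (hn : n ≠ 0) (C : ℝ) :
    IsOpen {y : EuclideanSpace ℝ (Fin n) |
      (omegaHat X R w y).det ≠ 0 ∧ C < testStat X R r w y} :=
  (continuousOn_testStat hn).isOpen_inter_preimage (isOpen_det_omegaHat_ne_zero hn) isOpen_Ioi

theorem isOpen_testStat_lt (hn : n ≠ 0) (C : ℝ) :
    IsOpen {y : EuclideanSpace ℝ (Fin n) |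
      (omegaHat X R w y).det ≠ 0 ∧ testStat X R r w y < C} :=
  (continuousOn_testStat hn).isOpen_inter_preimage (isOpen_det_omegaHat_ne_zero hn) isOpen_Iio

theorem omegaHat_mulVec_add (hn : n ≠ 0) (hX : X.rank = k) (β : Fin k → ℝ)
    (z : EuclideanSpace ℝ (Fin n)) :
    omegaHat X R w (WithLp.toLp 2 (X *ᵥ β) + z) = omegaHat X R w z := by
  simp only [omegaHat_eq hn, matB, resid_add, resid_mulVec hX, zero_add]

theorem omegaHat_smul (hn : n ≠ 0) (a : ℝ) (z : EuclideanSpace ℝ (Fin n)) :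
    omegaHat X R w (a • z) = a ^ 2 • omegaHat X R w z := by
  have hB : matB X R (a • z) = a • matB X R z := by
    rw [matB, matB, resid_smul, Matrix.diagonal_smul, Matrix.mul_smul]
  rw [omegaHat_eq hn, omegaHat_eq hn, hB, Matrix.transpose_smul, Matrix.mul_smul,
    Matrix.smul_mul, Matrix.smul_mul, smul_smul, sq]

theorem testStat_nullMean_add (hn : n ≠ 0) (hX : X.rank = k) {μ : EuclideanSpace ℝ (Fin n)}
    (hμ : μ ∈ nullMeans X R r) (z : EuclideanSpace ℝ (Fin n)) :
    testStat X R r w (μ + z) = testStat X R 0 w z := by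
  obtain ⟨β, rfl, hβ⟩ := hμ
  have h : R *ᵥ betaHat X (WithLp.toLp 2 (X *ᵥ β) + z) - r = R *ᵥ betaHat X z - 0 := by
    rw [betaHat_add, betaHat_mulVec hX, Matrix.mulVec_add, hβ, add_sub_cancel_left, sub_zero]
  simp only [testStat, omegaHat_mulVec_add hn hX, h]

/-- For `r = 0` the outer factors contribute `a²`, which cancels against the scaling of `Ω̂`; the
default branch is preserved as well. -/
theorem testStat_smul (hn : n ≠ 0) {a : ℝ} (ha : a ≠ 0) (z : EuclideanSpace ℝ (Fin n)) :
    testStat X R 0 w (a • z) = testStat X R 0 w z := by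
  have ha2 : a ^ 2 ≠ 0 := pow_ne_zero 2 ha
  have hdet : (omegaHat X R w (a • z)).det ≠ 0 ↔ (omegaHat X R w z).det ≠ 0 := by
    rw [omegaHat_smul hn, Matrix.det_smul]
    simp [ha]
  simp only [testStat, hdet]
  split_ifs with h
  · have hinv : (a ^ 2 • omegaHat X R w z)⁻¹ = (a ^ 2)⁻¹ • (omegaHat X R w z)⁻¹ :=
      Matrix.inv_smul' _ (Units.mk0 (a ^ 2) ha2) h.isUnit
    rw [omegaHat_smul hn, hinv, betaHat_smul]
    simp only [sub_zero, Matrix.mulVec_smul, Matrix.smul_mulVec, dotProduct_smul, smul_dotProduct,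
      smul_eq_mul]
    field_simp
  · rfl

end Statistic

end AutocorrRobust

namespace AutocorrRobust

/-! ### Almost sure nonsingularity of `Ω̂` and unboundedness of `T`. -/

section Generic

variable {n k q : ℕ} {X : Matrix (Fin n) (Fin k) ℝ} {R : Matrix (Fin q) (Fin k) ℝ}
  {r : Fin q → ℝ} {w : ℤ → ℝ}

/-- The `i`-th residual is a linear functional, so its kernel is null unless it is everything. If it
vanishes identically, symmetry of the hat matrix shows that `e_i` is its own fitted value and hence
lies in the span. -/
theorem ae_resid_ne_zero {i : Fin n} (hi : ¬ ∃ β : Fin k → ℝ, X *ᵥ β = Pi.single i 1) :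
    ∀ᵐ y : EuclideanSpace ℝ (Fin n), resid X y i ≠ 0 := by
  let L : EuclideanSpace ℝ (Fin n) →ₗ[ℝ] ℝ :=
    { toFun := fun y => resid X y i
      map_add' := fun y z => by rw [resid_add]; rfl
      map_smul' := fun a z => by rw [resid_smul]; rfl }
  have hL : LinearMap.ker L ≠ ⊤ := by
    intro htop
    have hzero : ∀ y, resid X y i = 0 := fun y => by
      have : y ∈ LinearMap.ker L := htop ▸ Submodule.mem_top
      exact this
    have hsymm : (X * ((Xᵀ * X)⁻¹ * Xᵀ))ᵀ = X * ((Xᵀ * X)⁻¹ * Xᵀ) := by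
      simp only [Matrix.transpose_mul, Matrix.transpose_transpose, Matrix.transpose_nonsing_inv,
        Matrix.mul_assoc]
    refine hi ⟨betaHat X (WithLp.toLp 2 (Pi.single i 1)), funext fun j => ?_⟩
    have h1 := hzero (WithLp.toLp 2 (Pi.single j 1))
    simp only [resid, betaHat, Matrix.mulVec_mulVec, Pi.sub_apply] at h1 ⊢
    rw [Matrix.mulVec_single_one, Matrix.col_apply] at h1 ⊢
    rw [← hsymm, Matrix.transpose_apply, ← sub_eq_zero.1 h1]
    simp [Pi.single_apply, eq_comm]
  have h0 := Measure.addHaar_submodule volume (LinearMap.ker L) hL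
  rw [ae_iff]
  convert h0 using 2
  ext y
  simp [L]

/-- Under the design assumption the covariance estimator is nonsingular almost everywhere. -/
theorem ae_det_omegaHat_ne_zero (hn : n ≠ 0) (hw : WeightAssumption n w)
    (hXR : DesignAssumption X R) :
    ∀ᵐ y : EuclideanSpace ℝ (Fin n), (omegaHat X R w y).det ≠ 0 := by
  classical
  have h : ∀ᵐ y : EuclideanSpace ℝ (Fin n),
      ∀ i : {i : Fin n // ¬ ∃ β : Fin k → ℝ, X *ᵥ β = Pi.single i 1}, resid X y i ≠ 0 :=
    ae_all_iff.2 fun i => ae_resid_ne_zero i.2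
  filter_upwards [h] with y hy
  refine det_omegaHat_ne_zero hn hw (le_antisymm ?_ ?_)
  · simpa using Matrix.rank_le_card_height (matB X R y)
  -- On the retained columns, `B` is the matrix of the design assumption times an invertible
  -- diagonal matrix, so the rank is preserved.
  · let v : {i : Fin n // ¬ ∃ β : Fin k → ℝ, X *ᵥ β = Pi.single i 1} → Fin n := Subtype.val
    have hsub : (matB X R y).submatrix id v =
        R * (Xᵀ * X)⁻¹ * Xᵀ.submatrix id v * Matrix.diagonal fun i => resid X y (v i) := by
      ext a b
      rw [Matrix.mul_diagonal, Matrix.submatrix_apply, matB, Matrix.mul_diagonal]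
      rfl
    have hdet : IsUnit (Matrix.diagonal fun i => resid X y (v i)).det := by
      rw [Matrix.det_diagonal]
      exact (Finset.prod_ne_zero_iff.2 fun i _ => hy i).isUnit
    have hrank := Matrix.rank_submatrix_le (matB X R y) id v
    rw [hsub, Matrix.rank_mul_eq_left_of_isUnit_det _ _ hdet] at hrank
    refine le_trans (le_of_eq ?_) hrank
    have := hXR
    unfold DesignAssumption at this
    convert this.symm

theorem exists_lt_testStat (hn : n ≠ 0) (hw : WeightAssumption n w) (hXR : DesignAssumption X R)
    (hX : X.rank = k) (hR : R.rank = q) (hq : 1 ≤ q) {C : ℝ} (hC : 0 < C) :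
    ∃ y, (omegaHat X R w y).det ≠ 0 ∧ C < testStat X R r w y := by
  obtain ⟨z, hz⟩ := (ae_det_omegaHat_ne_zero hn hw hXR).exists
  let v : Fin q → ℝ := fun _ => 1
  have hv : v ≠ 0 := fun h => one_ne_zero (congrFun h ⟨0, hq⟩)
  have hpos : 0 < v ⬝ᵥ (omegaHat X R w z)⁻¹ *ᵥ v := by
    simpa using (posDef_omegaHat_of_det_ne_zero hn hw hz).inv.dotProduct_mulVec_pos hv
  set c := v ⬝ᵥ (omegaHat X R w z)⁻¹ *ᵥ v with hc
  -- Translating by `X β` leaves `Ω̂` fixed and makes `R β̂ - r` equal to `(C/c + 1) v`, so that `T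
  -- = (C/c + 1)² c > C`.
  obtain ⟨β, hβ⟩ := mulVec_surjective_of_rank_eq hR ((C / c + 1) • v + r - R *ᵥ betaHat X z)
  refine ⟨WithLp.toLp 2 (X *ᵥ β) + z, by rwa [omegaHat_mulVec_add hn hX], ?_⟩
  have h : R *ᵥ betaHat X (WithLp.toLp 2 (X *ᵥ β) + z) - r = (C / c + 1) • v := by
    rw [betaHat_add, betaHat_mulVec hX, Matrix.mulVec_add, hβ]
    abel
  rw [testStat, omegaHat_mulVec_add hn hX, if_pos hz, h]
  simp only [Matrix.mulVec_smul, dotProduct_smul, smul_dotProduct, smul_eq_mul, ← hc]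
  have h1 : C / c * c = C := div_mul_cancel₀ C hpos.ne'
  have h2 : 0 < C / c := div_pos hC hpos
  nlinarith [mul_pos h2 hC]

end Generic

/-! ### Rejection probabilities and concentration within the model. -/

section Gaussian

open Filter Topology
open scoped MatrixOrder

variable {n : ℕ} {S : Matrix (Fin n) (Fin n) ℝ}

theorem sqrt_surjective (hS : S.PosDef) :
    Function.Surjective (toEuclideanCLM (𝕜 := ℝ) (CFC.sqrt S)) := by
  have h : CFC.sqrt S * (CFC.sqrt S * S⁻¹) = 1 := by
    rw [← mul_assoc, CFC.sqrt_mul_sqrt_self S hS.posSemidef.nonneg,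
      Matrix.mul_nonsing_inv _ ((Matrix.isUnit_iff_isUnit_det _).1 hS.isUnit)]
  intro y
  refine ⟨toEuclideanCLM (𝕜 := ℝ) (CFC.sqrt S * S⁻¹) y, ?_⟩
  rw [← mul_apply_eq_comp, ← map_mul, h, map_one]
  rfl

theorem multivariateGaussian_pos (hS : S.PosDef) (μ : EuclideanSpace ℝ (Fin n))
    {G : Set (EuclideanSpace ℝ (Fin n))} (hG : IsOpen G) (hne : G.Nonempty) :
    0 < multivariateGaussian μ S G := by
  rw [multivariateGaussian_apply _ _ hG.measurableSet]
  refine IsOpen.measure_pos _ (hG.preimage (by fun_prop)) ?_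
  obtain ⟨y, hy⟩ := hne
  obtain ⟨x, hx⟩ := sqrt_surjective hS (y - μ)
  exact ⟨x, by simpa [hx] using hy⟩

theorem multivariateGaussian_smul {σ : ℝ} (hσ : 0 < σ) (hS : S.PosSemidef)
    (μ : EuclideanSpace ℝ (Fin n)) {G : Set (EuclideanSpace ℝ (Fin n))} (hG : MeasurableSet G) :
    multivariateGaussian μ (σ ^ 2 • S) G =
      stdGaussian (EuclideanSpace ℝ (Fin n))
        {x | μ + σ • toEuclideanCLM (𝕜 := ℝ) (CFC.sqrt S) x ∈ G} := by
  have h : CFC.sqrt (σ ^ 2 • S) = σ • CFC.sqrt S := by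
    refine CFC.sqrt_unique ?_ ?_
    · rw [smul_mul_smul_comm, CFC.sqrt_mul_sqrt_self S hS.nonneg, sq]
    · exact Matrix.nonneg_iff_posSemidef.2
        ((Matrix.nonneg_iff_posSemidef.1 (CFC.sqrt_nonneg S)).smul hσ.le)
  rw [multivariateGaussian_apply _ _ hG, h]
  simp

/-- A sequence in the covariance model along which Gaussian laws degenerate to the
Gaussian law on `span E(ν)`. -/
theorem exists_concentrating {𝒞 : Set (Matrix (Fin n) (Fin n) ℝ)} (hpos : ∀ S ∈ 𝒞, S.PosDef)
    (hAR : arCovarianceModel n 2 ⊆ 𝒞) (ν : ℝ) :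
    ∃ S : ℕ → Matrix (Fin n) (Fin n) ℝ, (∀ m, S m ∈ 𝒞) ∧
      ∀ (G : Set (EuclideanSpace ℝ (Fin n))) (μ : ℕ → EuclideanSpace ℝ (Fin n))
        (μ₀ : EuclideanSpace ℝ (Fin n)) (σ : ℝ), IsOpen G → 0 < σ → Tendsto μ atTop (𝓝 μ₀) →
        (∀ᵐ z ∂lebesgueOn (seasonalSpan n ν), μ₀ + z ∈ G) →
        Tendsto (fun m => rejProb G (μ m) σ (S m)) atTop (𝓝 1) := by
  obtain ⟨S, hS, hlim⟩ := exists_tendsto_seasonal n ν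
  -- The sequence of covariances is fixed before the open set, means and scale, so it serves all of
  -- them.
  refine ⟨S, fun m => hAR (hS m), fun G μ μ₀ σ hG hσ hμ hae => ?_⟩
  exact tendsto_multivariateGaussian_one hμ
    (fun m => (hpos _ (hAR (hS m))).posSemidef.smul (sq_nonneg σ)) (posSemidef_limitCov n ν σ)
    (hlim.const_smul (σ ^ 2)) hG (ae_sqrt_limitCov hσ.ne' hae)

theorem rejProb_eq_of_scale {σ τ : ℝ} (hσ : 0 < σ) (hτ : 0 < τ) (hS : S.PosSemidef)
    {μ ν : EuclideanSpace ℝ (Fin n)} {G : Set (EuclideanSpace ℝ (Fin n))} (hG : MeasurableSet G)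
    (h : ∀ u, μ + σ • u ∈ G ↔ ν + τ • u ∈ G) : rejProb G μ σ S = rejProb G ν τ S := by
  rw [rejProb, rejProb, multivariateGaussian_smul hσ hS _ hG, multivariateGaussian_smul hτ hS _ hG]
  simp only [h]

theorem multivariateGaussian_null (hS : S.PosDef) {μ : EuclideanSpace ℝ (Fin n)}
    {N : Set (EuclideanSpace ℝ (Fin n))} (hN : MeasurableSet N)
    (h : ∀ᵐ x : EuclideanSpace ℝ (Fin n), μ + x ∉ N) : multivariateGaussian μ S N = 0 := by
  rw [multivariateGaussian_apply _ _ hN]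
  have hm : MeasurableSet {x | μ + x ∉ N} := ((measurable_const_add μ) hN).compl
  have hae := (ae_comp_linearMap_mem_iff (toEuclideanCLM (𝕜 := ℝ) (CFC.sqrt S)).toLinearMap
    volume volume (sqrt_surjective hS) hm).2 h
  have h0 := mem_ae_iff.1 ((stdGaussian_absolutelyContinuous n).ae_le hae)
  convert h0 using 2
  ext x
  simp

theorem rejProb_le_one (W : Set (EuclideanSpace ℝ (Fin n))) (μ : EuclideanSpace ℝ (Fin n)) (σ : ℝ)
    (S : Matrix (Fin n) (Fin n) ℝ) : rejProb W μ σ S ≤ 1 := by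
  unfold rejProb
  exact prob_le_one

theorem rejProb_le_one_sub {W G : Set (EuclideanSpace ℝ (Fin n))} (hG : IsOpen G)
    (hd : Disjoint W G) (μ : EuclideanSpace ℝ (Fin n)) (σ : ℝ) (S : Matrix (Fin n) (Fin n) ℝ) :
    rejProb W μ σ S ≤ 1 - rejProb G μ σ S := by
  unfold rejProb
  rw [← prob_compl_eq_one_sub hG.measurableSet]
  exact measure_mono hd.subset_compl_right

theorem tendsto_rejProb_zero {W G : Set (EuclideanSpace ℝ (Fin n))} (hG : IsOpen G)
    (hd : Disjoint W G) {μ : ℕ → EuclideanSpace ℝ (Fin n)} {σ : ℕ → ℝ}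
    {S : ℕ → Matrix (Fin n) (Fin n) ℝ}
    (h : Tendsto (fun m => rejProb G (μ m) (σ m) (S m)) atTop (𝓝 1)) :
    Tendsto (fun m => rejProb W (μ m) (σ m) (S m)) atTop (𝓝 0) := by
  have h1 : Tendsto (fun m => 1 - rejProb G (μ m) (σ m) (S m)) atTop (𝓝 (1 - 1)) :=
    ENNReal.Tendsto.sub tendsto_const_nhds h (Or.inl ENNReal.one_ne_top)
  rw [tsub_self] at h1
  exact tendsto_of_tendsto_of_tendsto_of_le_of_le tendsto_const_nhds h1 (fun m => bot_le)
    fun m => rejProb_le_one_sub hG hd _ _ _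

/-- The comparison of `G` with `W` is between probabilities, not sets, so that `G` may exceed `W` by
a null set, as happens in Part 3. -/
theorem iSup_rejProb_eq_one {𝒞 : Set (Matrix (Fin n) (Fin n) ℝ)} (hpos : ∀ S ∈ 𝒞, S.PosDef)
    (hAR : arCovarianceModel n 2 ⊆ 𝒞) {ν : ℝ} {W G : Set (EuclideanSpace ℝ (Fin n))}
    {μ₀ : EuclideanSpace ℝ (Fin n)} {σ : ℝ} (hσ : 0 < σ) (hG : IsOpen G)
    (hle : ∀ S ∈ 𝒞, rejProb G μ₀ σ S ≤ rejProb W μ₀ σ S)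
    (hae : ∀ᵐ z ∂lebesgueOn (seasonalSpan n ν), μ₀ + z ∈ G) :
    (⨆ S ∈ 𝒞, rejProb W μ₀ σ S) = 1 := by
  obtain ⟨S, hS, hlim⟩ := exists_concentrating hpos hAR ν
  refine le_antisymm (iSup₂_le fun S _ => rejProb_le_one _ _ _ _) ?_
  refine le_of_tendsto' (hlim G (fun _ => μ₀) μ₀ σ hG hσ tendsto_const_nhds hae) fun m => ?_
  exact (hle _ (hS m)).trans (le_iSup₂ (f := fun S (_ : S ∈ 𝒞) => rejProb W μ₀ σ S) _ (hS m))

end Gaussian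

/-! ### Size, the degenerate case `B = 0`, large scales and the seasonal example. -/

section Test

open Filter Topology

variable {n k q : ℕ} {X : Matrix (Fin n) (Fin k) ℝ} {R : Matrix (Fin q) (Fin k) ℝ}
  {r : Fin q → ℝ} {w : ℤ → ℝ} {𝒞 : Set (Matrix (Fin n) (Fin n) ℝ)}

theorem nullMeans_nonempty (hR : R.rank = q) : (nullMeans X R r).Nonempty := by
  obtain ⟨β, hβ⟩ := mulVec_surjective_of_rank_eq hR r
  exact ⟨_, β, rfl, hβ⟩

theorem size_eq_one {W : Set (EuclideanSpace ℝ (Fin n))} (hR : R.rank = q)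
    (h : ∀ μ₀ ∈ nullMeans X R r, ∀ σ : ℝ, 0 < σ → (⨆ S ∈ 𝒞, rejProb W μ₀ σ S) = 1) :
    size X R r 𝒞 W = 1 := by
  obtain ⟨μ₀, hμ₀⟩ := nullMeans_nonempty (X := X) (r := r) hR
  refine le_antisymm (iSup₂_le fun μ hμ => iSup₂_le fun σ hσ => (h μ hμ σ hσ).le) ?_
  refine le_iSup₂_of_le μ₀ hμ₀ (le_iSup₂_of_le 1 (Set.mem_Ioi.2 one_pos) ?_)
  exact (h μ₀ hμ₀ 1 one_pos).ge

/-- There is a sequence in the alternative that converges to a given point of the null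
hypothesis. -/
theorem exists_altMeans_tendsto (hR : R.rank = q) (hq : 1 ≤ q) {μ₀ : EuclideanSpace ℝ (Fin n)}
    (hμ₀ : μ₀ ∈ nullMeans X R r) :
    ∃ μ : ℕ → EuclideanSpace ℝ (Fin n), (∀ m, μ m ∈ altMeans X R r) ∧
      Tendsto μ atTop (𝓝 μ₀) := by
  obtain ⟨β, rfl, hβ⟩ := hμ₀
  -- Any multiple `a δ` with `a ≠ 0` violates the restriction, since `q ≥ 1` makes the all-ones
  -- vector nonzero.
  obtain ⟨δ, hδ⟩ := mulVec_surjective_of_rank_eq hR (fun _ => 1)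
  have hlim : Tendsto (fun m : ℕ => 1 / ((m : ℝ) + 1)) atTop (𝓝 0) :=
    tendsto_one_div_add_atTop_nhds_zero_nat
  refine ⟨fun m => WithLp.toLp 2 (X *ᵥ (β + (1 / ((m : ℝ) + 1)) • δ)),
    fun m => ⟨_, rfl, fun h => ?_⟩, ?_⟩
  · rw [Matrix.mulVec_add, hβ, Matrix.mulVec_smul, hδ, add_eq_left] at h
    have := congrFun h ⟨0, hq⟩
    simp only [Pi.smul_apply, smul_eq_mul, mul_one, Pi.zero_apply] at this
    exact (by positivity : (1 / ((m : ℝ) + 1)) ≠ 0) this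
  · have hc : Continuous fun a : ℝ => WithLp.toLp 2 (X *ᵥ (β + a • δ)) := by fun_prop
    have := (hc.tendsto 0).comp hlim
    rw [zero_smul, add_zero] at this
    exact this

theorem null_det_omegaHat (hn : n ≠ 0) (hX : X.rank = k) (hw : WeightAssumption n w)
    (hXR : DesignAssumption X R) {μ : EuclideanSpace ℝ (Fin n)} (hμ : μ ∈ nullMeans X R r)
    {S : Matrix (Fin n) (Fin n) ℝ} (hS : S.PosDef) :
    multivariateGaussian μ S {y | (omegaHat X R w y).det = 0} = 0 := by
  obtain ⟨β, rfl, -⟩ := hμ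
  have ho := isOpen_det_omegaHat_ne_zero (X := X) (R := R) (w := w) hn
  have hm : MeasurableSet {y | (omegaHat X R w y).det = 0} := by
    have := ho.measurableSet.compl
    simpa [Set.compl_ofPred] using this
  refine multivariateGaussian_null hS hm ?_
  filter_upwards [ae_det_omegaHat_ne_zero hn hw hXR] with x hx
  rwa [omegaHat_mulVec_add hn hX]

theorem iSup_rejProb_of_matB_eq_zero (hn : n ≠ 0) (hX : X.rank = k) (hw : WeightAssumption n w)
    (hXR : DesignAssumption X R) (hpos : ∀ S ∈ 𝒞, S.PosDef) (hAR : arCovarianceModel n 2 ⊆ 𝒞)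
    {C : ℝ} {ν : ℝ}
    (h : ∀ᵐ z ∂lebesgueOn (seasonalSpan n ν), matB X R z = 0 ∧ R *ᵥ betaHat X z ≠ 0) :
    ∀ μ₀ ∈ nullMeans X R r, ∀ σ : ℝ, 0 < σ →
      (⨆ S ∈ 𝒞, rejProb (rejRegion X R r w C) μ₀ σ S) = 1 := by
  intro μ₀ hμ₀ σ hσ
  let v : EuclideanSpace ℝ (Fin n) → Fin q → ℝ := fun y => R *ᵥ betaHat X y - r
  have hv : Continuous v := by fun_prop
  have hΩ : Continuous (omegaHat X R w) := continuous_omegaHat hn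
  have hG : IsOpen {y | C * (v y ⬝ᵥ omegaHat X R w y *ᵥ v y) < (v y ⬝ᵥ v y) ^ 2} :=
    isOpen_lt (continuous_const.mul (hv.dotProduct (hΩ.matrix_mulVec hv)))
      ((hv.dotProduct hv).pow 2)
  refine iSup_rejProb_eq_one hpos hAR (ν := ν) hσ hG (fun S hS => ?_) ?_
  -- Off the singular set, Cauchy-Schwarz turns the open inequality into `T > C`.
  · have hsub : {y | C * (v y ⬝ᵥ omegaHat X R w y *ᵥ v y) < (v y ⬝ᵥ v y) ^ 2} ⊆
        rejRegion X R r w C ∪ {y | (omegaHat X R w y).det = 0} := by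
      intro y hy
      by_cases hdet : (omegaHat X R w y).det = 0
      · exact Or.inr hdet
      · refine Or.inl ?_
        have := lt_quadForm_inv (posDef_omegaHat_of_det_ne_zero hn hw hdet) hy
        rw [rejRegion, Set.mem_ofPred, testStat, if_pos hdet]
        exact this.le
    refine (measure_mono hsub).trans ((measure_union_le _ _).trans ?_)
    rw [null_det_omegaHat hn hX hw hXR hμ₀ ((hpos S hS).smul (pow_pos hσ 2)), add_zero]
    rfl
  · filter_upwards [h] with z hz
    obtain ⟨β, rfl, hβ⟩ := hμ₀
    have hvz : v (WithLp.toLp 2 (X *ᵥ β) + z) = R *ᵥ betaHat X z := by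
      simp only [v]
      rw [betaHat_add, betaHat_mulVec hX, Matrix.mulVec_add, hβ, add_sub_cancel_left]
    have hΩz : omegaHat X R w z = 0 := by
      rw [omegaHat_eq hn, hz.1, Matrix.zero_mul, Matrix.zero_mul]
    rw [hvz, omegaHat_mulVec_add hn hX, hΩz]
    -- With `Ω̂ = 0` the left side is zero for every `C`, while the right side is the squared form
    -- of a nonzero vector.
    simp only [Matrix.zero_mulVec, dotProduct_zero, mul_zero]
    have : R *ᵥ betaHat X z ⬝ᵥ R *ᵥ betaHat X z ≠ 0 := fun h0 => hz.2 (dotProduct_self_eq_zero.1 h0)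
    positivity

theorem tendsto_rejProb_large_scale (hn : n ≠ 0) (hX : X.rank = k) (hR : R.rank = q) {C : ℝ}
    {S : ℕ → Matrix (Fin n) (Fin n) ℝ} (hS : ∀ m, (S m).PosDef)
    (hlim : ∀ (μ : ℕ → EuclideanSpace ℝ (Fin n)) (μ₀ : EuclideanSpace ℝ (Fin n)),
      μ₀ ∈ nullMeans X R r → Tendsto μ atTop (𝓝 μ₀) →
      Tendsto (fun m => rejProb
        {y | (omegaHat X R w y).det ≠ 0 ∧ testStat X R r w y < C} (μ m) 1 (S m)) atTop (𝓝 1))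
    (μ : EuclideanSpace ℝ (Fin n)) :
    Tendsto (fun m : ℕ => rejProb
      {y | (omegaHat X R w y).det ≠ 0 ∧ testStat X R r w y < C} μ ((m : ℝ) + 1) (S m))
      atTop (𝓝 1) := by
  obtain ⟨μ₀, hμ₀⟩ := nullMeans_nonempty (X := X) (r := r) hR
  have hG := isOpen_testStat_lt (X := X) (R := R) (r := r) (w := w) hn C
  have hsc : Tendsto (fun m : ℕ => μ₀ + (1 / ((m : ℝ) + 1)) • (μ - μ₀)) atTop (𝓝 μ₀) := by
    have h0 : Tendsto (fun m : ℕ => 1 / ((m : ℝ) + 1)) atTop (𝓝 0) :=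
      tendsto_one_div_add_atTop_nhds_zero_nat
    simpa using (h0.smul_const (μ - μ₀)).const_add μ₀
  refine (hlim _ μ₀ hμ₀ hsc).congr fun m => ?_
  have hm : (0 : ℝ) < (m : ℝ) + 1 := by positivity
  refine rejProb_eq_of_scale one_pos hm (hS m).posSemidef hG.measurableSet fun u => ?_
  have e1 : μ₀ + (1 / ((m : ℝ) + 1)) • (μ - μ₀) + (1 : ℝ) • u =
      μ₀ + ((1 / ((m : ℝ) + 1)) • (μ - μ₀) + u) := by rw [one_smul, add_assoc]
  have e2 : μ + ((m : ℝ) + 1) • u =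
      -- A draw with mean `μ` and scale `m + 1`, contracted about `μ₀` by `m + 1`, has scale one and
      -- mean `μ₀ + (μ - μ₀)/(m + 1)`, which tends to `μ₀`.
      μ₀ + ((m : ℝ) + 1) • ((1 / ((m : ℝ) + 1)) • (μ - μ₀) + u) := by
    rw [smul_add, smul_smul, mul_one_div_cancel hm.ne', one_smul]
    abel
  rw [Set.mem_ofPred, Set.mem_ofPred, e1, e2, testStat_nullMean_add hn hX hμ₀,
    testStat_nullMean_add hn hX hμ₀, testStat_smul hn hm.ne']
  obtain ⟨β, rfl, -⟩ := hμ₀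
  rw [omegaHat_mulVec_add hn hX, omegaHat_mulVec_add hn hX, omegaHat_smul hn, Matrix.det_smul]
  simp [hm.ne']

theorem size_pos (hn : n ≠ 0) (hX : X.rank = k) (hR : R.rank = q) (hq : 1 ≤ q)
    (hw : WeightAssumption n w) (hXR : DesignAssumption X R) (hpos : ∀ S ∈ 𝒞, S.PosDef)
    (hne : 𝒞.Nonempty) {C : ℝ} (hC : 0 < C) : 0 < size X R r 𝒞 (rejRegion X R r w C) := by
  obtain ⟨μ₀, hμ₀⟩ := nullMeans_nonempty (X := X) (r := r) hR
  obtain ⟨S, hS⟩ := hne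
  have hG := isOpen_lt_testStat (X := X) (R := R) (r := r) (w := w) hn C
  have h1 : 0 < rejProb (rejRegion X R r w C) μ₀ 1 S :=
    (multivariateGaussian_pos ((hpos S hS).smul (by norm_num)) μ₀ hG
      (exists_lt_testStat hn hw hXR hX hR hq hC)).trans_le (measure_mono fun y hy => hy.2.le)
  refine h1.trans_le ?_
  refine le_iSup₂_of_le μ₀ hμ₀ (le_iSup₂_of_le 1 (Set.mem_Ioi.2 one_pos) ?_)
  exact le_iSup₂ (f := fun S (_ : S ∈ 𝒞) => rejProb (rejRegion X R r w C) μ₀ 1 S) S hS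

/-- If the seasonal span is contained in the column space of `X` and `R` does not annihilate
the corresponding coefficients, then `B` vanishes there. -/
theorem ae_matB_eq_zero_of_seasonal (hk2 : 2 ≤ k) (hX : X.rank = k) (hq2 : q = 2) {ν : ℝ}
    (hE : ∀ (t : Fin n) (j : Fin 2), X t (Fin.castLE hk2 j) = seasonalMatrix n ν t j)
    (hRI : ∀ (i : Fin q) (l : Fin k), R i l = if (i : ℕ) = (l : ℕ) then 1 else 0) :
    ∀ᵐ z ∂lebesgueOn (seasonalSpan n ν), matB X R z = 0 ∧ R *ᵥ betaHat X z ≠ 0 := by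
  subst hq2
  have hR' : ∀ β : Fin k → ℝ, R *ᵥ β = fun i => β (Fin.castLE hk2 i) := fun β => by
    ext i
    have : ∀ l : Fin k, (i : ℕ) = l ↔ Fin.castLE hk2 i = l := fun l => by simp [Fin.ext_iff]
    simp [Matrix.mulVec, dotProduct, hRI, this]
  have hEX : seasonalMatrix n ν = X * Rᵀ := by
    ext t j
    have : ∀ l : Fin k, (j : ℕ) = l ↔ Fin.castLE hk2 j = l := fun l => by simp [Fin.ext_iff]
    simp [Matrix.mul_apply, hRI, this, ← hE]
  have hRR : ∀ a : Fin 2 → ℝ, R *ᵥ (Rᵀ *ᵥ a) = a := fun a => by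
    rw [hR']
    ext i
    have : ∀ l : Fin 2, (l : ℕ) = i ↔ l = i := fun l => by simp [Fin.ext_iff]
    simp [Matrix.mulVec, dotProduct, hRI, this]
  have hspan : ∀ z ∈ seasonalSpan n ν, z ≠ 0 → matB X R z = 0 ∧ R *ᵥ betaHat X z ≠ 0 := by
    intro z hz hz0
    obtain ⟨a, ha⟩ := mem_seasonalSpan.1 hz
    have hz' : z = WithLp.toLp 2 (X *ᵥ (Rᵀ *ᵥ a)) := by
      rw [Matrix.mulVec_mulVec, ← hEX, ← ha]
    rw [hz', matB, resid_mulVec hX, betaHat_mulVec hX, hRR]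
    refine ⟨by simp, fun h0 => hz0 ?_⟩
    rw [hz', h0]
    simp
  -- On the trivial space Haar measure charges the origin; discarding `z = 0` requires a nonzero
  -- span, which the full rank of `X` supplies.
  have hnt : Nontrivial (seasonalSpan n ν) := by
    rw [Submodule.nontrivial_iff_ne_bot, Submodule.ne_bot_iff]
    refine ⟨WithLp.toLp 2 (seasonalMatrix n ν *ᵥ fun _ => 1), mem_seasonalSpan.2 ⟨fun _ => 1, rfl⟩,
      fun h0 => ?_⟩
    have h1 : X *ᵥ (Rᵀ *ᵥ fun _ => 1) = X *ᵥ 0 := by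
      rw [Matrix.mulVec_mulVec, ← hEX, Matrix.mulVec_zero]
      exact congrArg WithLp.ofLp h0
    have h2 := hRR fun _ => 1
    rw [mulVec_injective_of_rank_eq hX h1, Matrix.mulVec_zero] at h2
    exact zero_ne_one (congrFun h2 0)
  rw [ae_lebesgueOn_iff]
  have h0 : ∀ᵐ z : seasonalSpan n ν
      ∂((stdOrthonormalBasis ℝ (seasonalSpan n ν)).toBasis.addHaar), z ≠ 0 := by
    rw [ae_iff]
    simp
  filter_upwards [h0] with z hz
  exact hspan z z.2 fun h => hz (Subtype.ext h)

end Test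

end AutocorrRobust

/-! ### The size and power statements and the seasonality example. -/

theorem theorem3p6 {n k q : ℕ} (hn : 3 ≤ n) (hk : 1 ≤ k) (hkn : k < n) (hq : 1 ≤ q)
    (X : Matrix (Fin n) (Fin k) ℝ) (hX : X.rank = k)
    (R : Matrix (Fin q) (Fin k) ℝ) (hR : R.rank = q) (r : Fin q → ℝ)
    (𝒞 : Set (Matrix (Fin n) (Fin n) ℝ)) (hpos : ∀ S ∈ 𝒞, S.PosDef)
    (hAR : arCovarianceModel n 2 ⊆ 𝒞)
    (w : ℤ → ℝ) (hw : WeightAssumption n w)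
    (hXR : DesignAssumption X R)
    (C : ℝ) (hC : 0 < C) :
    -- Part 1
    ((∀ ν ∈ Set.Icc 0 Real.pi,
        (∃ μs ∈ nullMeans X R r,
          ∀ᵐ z ∂(lebesgueOn (seasonalSpan n ν)),
            (matB X R z).rank = q ∧
              C < testStat X R r w (z + μs)) →
        (∀ μs ∈ nullMeans X R r,
          ∀ᵐ z ∂(lebesgueOn (seasonalSpan n ν)),
            (matB X R z).rank = q ∧
              C < testStat X R r w (z + μs)) ∧
        (∀ μ₀ ∈ nullMeans X R r, ∀ σ : ℝ, 0 < σ →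
          (⨆ S ∈ 𝒞, rejProb (rejRegion X R r w C) μ₀ σ S) = 1) ∧
        size X R r 𝒞 (rejRegion X R r w C) = 1)) ∧
    -- Part 2
    ((∀ ν ∈ Set.Icc 0 Real.pi,
        (∃ μs ∈ nullMeans X R r,
          ∀ᵐ z ∂(lebesgueOn (seasonalSpan n ν)),
            (matB X R z).rank = q ∧
              testStat X R r w (z + μs) < C) →
        (∀ μs ∈ nullMeans X R r,
          ∀ᵐ z ∂(lebesgueOn (seasonalSpan n ν)),
            (matB X R z).rank = q ∧
              testStat X R r w (z + μs) < C) ∧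
        (∀ μ₀ ∈ nullMeans X R r, ∀ σ : ℝ, 0 < σ →
          (⨅ S ∈ 𝒞, rejProb (rejRegion X R r w C) μ₀ σ S) = 0) ∧
        (∀ σ : ℝ, 0 < σ →
          (⨅ μ₁ ∈ altMeans X R r, ⨅ S ∈ 𝒞, rejProb (rejRegion X R r w C) μ₁ σ S) = 0) ∧
        IsBiased X R r 𝒞 (rejRegion X R r w C) ∧
        (∀ μ₁ ∈ altMeans X R r,
          (⨅ σ ∈ Set.Ioi (0 : ℝ), ⨅ S ∈ 𝒞, rejProb (rejRegion X R r w C) μ₁ σ S) = 0) ∧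
        infimalPower X R r 𝒞 (rejRegion X R r w C) = 0)) ∧
    -- Part 3
    ((∀ ν ∈ Set.Icc 0 Real.pi,
        (∀ᵐ z ∂lebesgueOn (seasonalSpan n ν),
          matB X R z = 0 ∧ R *ᵥ betaHat X z ≠ 0) →
        (∀ μ₀ ∈ nullMeans X R r, ∀ σ : ℝ, 0 < σ →
          (⨆ S ∈ 𝒞, rejProb (rejRegion X R r w C) μ₀ σ S) = 1) ∧
        size X R r 𝒞 (rejRegion X R r w C) = 1)) ∧
    -- Example: X = (E(ν), X₂), R = (I₂, 0), r = 0 (absence of seasonality at frequency ν)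
    (∀ ν ∈ Set.Ioo 0 Real.pi, ∀ hk2 : 2 ≤ k, q = 2 →
        (∀ (t : Fin n) (j : Fin 2),
          X t (Fin.castLE hk2 j) = seasonalMatrix n ν t j) →
        (∀ (i : Fin q) (l : Fin k), R i l = if (i : ℕ) = (l : ℕ) then 1 else 0) →
        r = 0 →
        size X R r 𝒞 (rejRegion X R r w C) = 1) := by
  have hn0 : n ≠ 0 := by omega
  obtain ⟨μ₀', hμ₀'⟩ := nullMeans_nonempty (X := X) (r := r) hR
  have part3 : ∀ ν : ℝ, (∀ᵐ z ∂lebesgueOn (seasonalSpan n ν),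
      matB X R z = 0 ∧ R *ᵥ betaHat X z ≠ 0) →
      (∀ μ₀ ∈ nullMeans X R r, ∀ σ : ℝ, 0 < σ →
        (⨆ S ∈ 𝒞, rejProb (rejRegion X R r w C) μ₀ σ S) = 1) ∧
      size X R r 𝒞 (rejRegion X R r w C) = 1 := fun ν h => by
    have h1 := iSup_rejProb_of_matB_eq_zero (r := r) (C := C) hn0 hX hw hXR hpos hAR h
    exact ⟨h1, size_eq_one hR h1⟩
  have hstat : ∀ μ ∈ nullMeans X R r, ∀ z,
      testStat X R r w (z + μ) = testStat X R 0 w z := fun μ hμ z => by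
    rw [add_comm, testStat_nullMean_add hn0 hX hμ]
  have hdet : ∀ μ ∈ nullMeans X R r, ∀ z, (matB X R z).rank = q →
      (omegaHat X R w (μ + z)).det ≠ 0 := by
    rintro μ ⟨β, rfl, -⟩ z hz
    rw [omegaHat_mulVec_add hn0 hX]
    exact det_omegaHat_ne_zero hn0 hw hz
  refine ⟨fun ν _ h => ?_, fun ν _ h => ?_, fun ν _ h => part3 ν h, fun ν _ hk2 hq2 hE hRI _ =>
    (part3 ν (ae_matB_eq_zero_of_seasonal hk2 hX hq2 hE hRI)).2⟩
  · have hall : ∀ μs ∈ nullMeans X R r, ∀ᵐ z ∂(lebesgueOn (seasonalSpan n ν)),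
        (matB X R z).rank = q ∧ C < testStat X R r w (z + μs) := by
      obtain ⟨μs, hμs, hae⟩ := h
      intro μ hμ
      filter_upwards [hae] with z hz
      rwa [hstat μ hμ, ← hstat μs hμs]
    have hsup : ∀ μ₀ ∈ nullMeans X R r, ∀ σ : ℝ, 0 < σ →
        (⨆ S ∈ 𝒞, rejProb (rejRegion X R r w C) μ₀ σ S) = 1 := by
      intro μ₀ hμ₀ σ hσ
      refine iSup_rejProb_eq_one hpos hAR (ν := ν) hσ
        (isOpen_lt_testStat (X := X) (R := R) (r := r) (w := w) hn0 C)
        (fun S _ => measure_mono fun y hy => hy.2.le) ?_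
      filter_upwards [hall μ₀ hμ₀] with z hz
      exact ⟨hdet μ₀ hμ₀ z hz.1, by rw [add_comm]; exact hz.2⟩
    exact ⟨hall, hsup, size_eq_one hR hsup⟩
  · have hall : ∀ μs ∈ nullMeans X R r, ∀ᵐ z ∂(lebesgueOn (seasonalSpan n ν)),
        (matB X R z).rank = q ∧ testStat X R r w (z + μs) < C := by
      obtain ⟨μs, hμs, hae⟩ := h
      intro μ hμ
      filter_upwards [hae] with z hz
      rwa [hstat μ hμ, ← hstat μs hμs]
    obtain ⟨S, hS, hlim⟩ := exists_concentrating hpos hAR ν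
    have hGo := isOpen_testStat_lt (X := X) (R := R) (r := r) (w := w) hn0 C
    have hd : Disjoint (rejRegion X R r w C)
        {y | (omegaHat X R w y).det ≠ 0 ∧ testStat X R r w y < C} :=
      Set.disjoint_left.2 fun y h1 h2 => absurd h2.2 (not_lt.2 h1)
    have hlim' : ∀ (μ : ℕ → EuclideanSpace ℝ (Fin n)) (μ₀ : EuclideanSpace ℝ (Fin n)) (σ : ℝ),
        μ₀ ∈ nullMeans X R r → 0 < σ → Filter.Tendsto μ Filter.atTop (nhds μ₀) →
        Filter.Tendsto (fun m => rejProb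
          {y | (omegaHat X R w y).det ≠ 0 ∧ testStat X R r w y < C} (μ m) σ (S m))
          Filter.atTop (nhds 1) := by
      intro μ μ₀ σ hμ₀ hσ hμ
      refine hlim _ μ μ₀ σ hGo hσ hμ ?_
      filter_upwards [hall μ₀ hμ₀] with z hz
      exact ⟨hdet μ₀ hμ₀ z hz.1, by rw [add_comm]; exact hz.2⟩
    -- Alternatives converging to a null mean inherit the degenerate limit, so their rejection
    -- probabilities tend to zero.
    obtain ⟨μa, hμa, hμalim⟩ := exists_altMeans_tendsto hR hq hμ₀'
    have hlarge : ∀ μ₁ ∈ altMeans X R r,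
        (⨅ σ ∈ Set.Ioi (0 : ℝ), ⨅ S ∈ 𝒞, rejProb (rejRegion X R r w C) μ₁ σ S) = 0 := by
      intro μ₁ _
      have ht := tendsto_rejProb_zero hGo hd
        (tendsto_rejProb_large_scale hn0 hX hR (fun m => hpos _ (hS m))
          (fun μ μ₀ hμ₀ hμ => hlim' μ μ₀ 1 hμ₀ one_pos hμ) μ₁)
      refine le_antisymm (ge_of_tendsto' ht fun m => ?_) bot_le
      exact iInf₂_le_of_le ((m : ℝ) + 1) (Set.mem_Ioi.2 (by positivity))
        (iInf₂_le_of_le (S m) (hS m) le_rfl)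
    refine ⟨hall, fun μ₀ hμ₀ σ hσ => ?_, fun σ hσ => ?_, ?_, hlarge, ?_⟩
    · have ht := tendsto_rejProb_zero hGo hd (hlim' _ μ₀ σ hμ₀ hσ tendsto_const_nhds)
      exact le_antisymm (ge_of_tendsto' ht fun m => iInf₂_le_of_le (S m) (hS m) le_rfl) bot_le
    · have ht := tendsto_rejProb_zero hGo hd (hlim' μa μ₀' σ hμ₀' hσ hμalim)
      exact le_antisymm (ge_of_tendsto' ht fun m => iInf₂_le_of_le (μa m) (hμa m)
        (iInf₂_le_of_le (S m) (hS m) le_rfl)) bot_le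
    · have ht := tendsto_rejProb_zero hGo hd (hlim' μa μ₀' 1 hμ₀' one_pos hμalim)
      -- Power tending to zero eventually drops below the strictly positive size, which gives bias.
      obtain ⟨m, hm⟩ := (ht.eventually_lt_const
        (size_pos (r := r) hn0 hX hR hq hw hXR hpos ⟨_, hS 0⟩ hC)).exists
      exact ⟨μa m, hμa m, 1, Set.mem_Ioi.2 one_pos, S m, hS m, hm⟩
    · exact le_antisymm ((iInf₂_le (μa 0) (hμa 0)).trans (hlarge _ (hμa 0)).le) bot_le
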